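/- Let $(\mathbb{X},\mathcal{F},\mu)$ be a probability space. A connection function is a measurable symmetric function $\phi:\mathbb{X}\times\mathbb{X}\to[0,1]$; for $\varepsilon>0$ it is called $\varepsilon$-homogeneous if $\inf_{x\in\mathbb{X}}\int\phi(x,y)\,\mu(dy)\ \ge\ \varepsilon\,\sup_{x\in\mathbb{X}}\int\phi(x,y)\,\mu(dy)$. For $s>0$ let $\mathcal{P}_s$ be a Poisson point process on $\mathbb{X}$ with mean measure $s\mu$ (points counted with multiplicity), realized as $X_1,\dots,X_{Z}$ with $X_1,X_2,\dots$ independent with law $\mu$ and $Z$ an independent Poisson($s$) variable. Let $G(\mathcal{P}_s,\phi)$ be the random graph whose vertices are the points of $\mathcal{P}_s$, where, given $\mathcal{P}_s$, each pair of points $x,y$ is joined by an edge with probability $\phi(x,y)$, independently of all other pairs. For a finite graph $G$ let $H_k(G)$ be the number of connected induced subgraphs of $G$ with exactly $k$ vertices. **Theorem.** Let $\varepsilon>0$, let $k\ge 2$ be an integer, and for every $s>0$ let $\phi_s$ be an $\varepsilon$-homogeneous connection function (with $\varepsilon$ not depending on $s$). Put $G_s=G(\mathcal{P}_s,\phi_s)$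 and $\alpha_s=\mathbb{E}\,H_k(G_s)$. (i) If $\alpha_s\to\alpha\in(0,\infty)$ as $s\to\infty$, then $H_k(G_s)$ converges in distribution, as $s\to\infty$, to a Poisson random variable with mean $\alpha$. (ii) If $\alpha_s\to\infty$ and $\alpha_s=o(s)$ as $s\to\infty$, then $(H_k(G_s)-\alpha_s)/\sqrt{\alpha_s}$ converges in distribution, as $s\to\infty$, to a standard normal random variable. -/

import Mathlib

open MeasureTheory ProbabilityTheory Filter Topology Asymptotics
open scoped NNReal unitInterval

/-- A connection function on the state space `𝕏`: a measurable symmetric function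
`𝕏 × 𝕏 → [0, 1]`. -/
structure IsConnectionFunction {𝕏 : Type*} [MeasurableSpace 𝕏] (φ : 𝕏 → 𝕏 → ℝ) : Prop where
  measurable : Measurable (Function.uncurry φ)
  symm : ∀ x y, φ x y = φ y x
  nonneg : ∀ x y, 0 ≤ φ x y
  le_one : ∀ x y, φ x y ≤ 1

/-- `φ` is an `ε`-homogeneous connection function: the infimum over `x` of `∫ φ(x, y) μ(dy)` is at
least `ε` times the supremum over `x`. (For a connection function and a probability measure these
integrals lie in `[0, 1]`, so the infimum and supremum are genuine.) -/
structure IsHomogeneousConnection {𝕏 : Type*} [MeasurableSpace 𝕏] (μ : Measure 𝕏) (ε : ℝ)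
    (φ : 𝕏 → 𝕏 → ℝ) : Prop extends IsConnectionFunction φ where
  homogeneous : ε * (⨆ x, ∫ y, φ x y ∂μ) ≤ ⨅ x, ∫ y, φ x y ∂μ

/-- The number of connected induced subgraphs of order `k` of a finite graph, i.e. the number of
`k`-element vertex sets which induce a connected subgraph. -/
noncomputable def connInducedCount {V : Type*} [Finite V] (k : ℕ) (G : SimpleGraph V) : ℕ :=
  Set.ncard {S : Set V | S.ncard = k ∧ (G.induce S).Connected}

/-- The sample space: a number of points `Z`, a sequence of points `X 0, X 1, …` of `𝕏`, and an
array of marks `T i j` in the unit interval. -/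
abbrev IRGSample (𝕏 : Type*) : Type _ := ℕ × (ℕ → 𝕏) × (ℕ → ℕ → I)

/-- The law of the sample at intensity `s`: `Z` is Poisson with mean `s`, the points `X i` are
i.i.d. with law `μ`, the marks `T i j` are i.i.d. uniform on the unit interval, and all of these are
independent. Thus `{X 0, …, X (Z - 1)}`, counted with multiplicity, is a Poisson process
with mean measure `s μ`. -/
noncomputable def irgLaw {𝕏 : Type*} [MeasurableSpace 𝕏] (μ : Measure 𝕏) (s : ℝ≥0) :
    Measure (IRGSample 𝕏) :=
  (poissonMeasure s).prod
    ((Measure.infinitePi fun _ : ℕ => μ).prod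
      (Measure.infinitePi fun _ : ℕ => Measure.infinitePi fun _ : ℕ => (volume : Measure I)))

instance {𝕏 : Type*} [MeasurableSpace 𝕏] (μ : Measure 𝕏) [IsProbabilityMeasure μ] (s : ℝ≥0) :
    IsProbabilityMeasure (irgLaw μ s) := by
  unfold irgLaw; infer_instance

/-- The inhomogeneous random graph `G(P_s, φ)`. Its vertices are (the labels `0, …, Z - 1` of) the
points `X 0, …, X (Z - 1)`; for `i < j` there is an edge between `X i` and `X j` if and only if
`T i j ≤ φ (X i) (X j)`. -/
def irgGraph {𝕏 : Type*} (φ : 𝕏 → 𝕏 → ℝ) (ω : IRGSample 𝕏) : SimpleGraph (Fin ω.1) :=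
  SimpleGraph.fromRel fun i j => i < j ∧ (ω.2.2 i j : ℝ) ≤ φ (ω.2.1 i) (ω.2.1 j)

/-- The random variable `H_k(G(P_s, φ))`, on the sample space. -/
noncomputable def irgCount {𝕏 : Type*} (k : ℕ) (φ : 𝕏 → 𝕏 → ℝ) (ω : IRGSample 𝕏) : ℕ :=
  connInducedCount k (irgGraph φ ω)

/-- The expectation of `H_k(G(P_s, φ))` (a random variable with values in `[0, Z ^ k]`, where `Z` is
Poisson, so that its expectation is finite). -/
noncomputable def irgMean {𝕏 : Type*} [MeasurableSpace 𝕏] (μ : Measure 𝕏) (k : ℕ)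
    (φ : 𝕏 → 𝕏 → ℝ) (s : ℝ≥0) : ℝ :=
  ∫ ω, (irgCount k φ ω : ℝ) ∂(irgLaw μ s)

/-! The proof is the Chen–Stein method in Fourier form. Let `H` be the count, `α` its mean and `ψ(t)
= E exp(itH)`. The characteristic function of Poisson(`α`) solves `ψ' = iα exp(it) ψ`, `ψ(0) = 1`,
so it suffices that `ψ` solves this equation up to a small error.

Write `E[H exp(itH)]` as a sum over `k`-sets `S` of labels. If `S` is connected, then `H` is 1 plus
the count avoiding `S` plus the number of other connected `k`-sets meeting `S` (`connCount_eq_add`).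
The count avoiding `S` is independent of the connectedness of `S`, and after deleting `k` points the
Poisson number of points is again Poisson(`s`) (`integral_choose_mul_poissonMeasure`, a Mecke
formula). This yields the main term `α exp(it) ψ(t)`. Two connected sets that meet have a connected
union, so the error is at most `|t|` times a sum `R` over connected sets of `m` vertices, `k < m <
2k`. An integrating factor then gives a distance of at most `R t² exp(α t²/2)` to the Poisson
characteristic function (`norm_irgCharFun_sub_le`).

Homogeneity controls `R`. With `p` the maximal connection integral, `m` labels are connected with
probability at most a constant times `p^(m-1)`, and `k` labels with probability at least
`(εp)^(k-1)`. Hence `R ≤ α Q(sp)` for a polynomial `Q` with `Q(0) = 0`. The lower bound also makes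
`α/s` at least a constant times `(sp)^(k-1)`, so `α = o(s)` forces `sp → 0`. At a fixed `t` and with
`α` convergent this gives (i). At `t/√α` the quantity `α (t/√α)²` stays equal to `t²`, so the error
still vanishes, and (ii) follows from the central limit theorem for Poisson variables. -/

/-! ### Product measures: splicing independent copies and relabelling -/

lemma measurePreserving_prod_prod_swap {α β γ δ : Type*} [MeasurableSpace α] [MeasurableSpace β]
    [MeasurableSpace γ] [MeasurableSpace δ] (a : Measure α) (b : Measure β) (c : Measure γ)
    (d : Measure δ) [SFinite a] [SFinite b] [SFinite c] [SFinite d] :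
    MeasurePreserving (fun z : (α × β) × (γ × δ) => ((z.1.1, z.2.1), (z.1.2, z.2.2)))
      ((a.prod b).prod (c.prod d)) ((a.prod c).prod (b.prod d)) := by
  have h1 := measurePreserving_prodAssoc a b (c.prod d)
  have h2 := (MeasurePreserving.id a).prod ((measurePreserving_prodAssoc b c d).symm)
  have h3 := (MeasurePreserving.id a).prod
    ((Measure.measurePreserving_swap (μ := b) (ν := c)).prod (MeasurePreserving.id d))
  have h4 := (MeasurePreserving.id a).prod (measurePreserving_prodAssoc c b d)
  have h5 := (measurePreserving_prodAssoc a c (b.prod d)).symm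
  exact h5.comp (h4.comp (h3.comp (h2.comp h1)))

section Product

variable {ι α : Type*} [MeasurableSpace α] (μ : Measure α) [IsProbabilityMeasure μ]

open scoped Classical in
/-- Take the coordinates in `A` from the first function, the others from the second. -/
noncomputable def mixFun {α : Type*} (A : Set ι) (x : (ι → α) × (ι → α)) : ι → α :=
  fun i => if i ∈ A then x.1 i else x.2 i

lemma mixFun_of_mem {α : Type*} {A : Set ι} {i : ι} (h : i ∈ A) (x : (ι → α) × (ι → α)) :
    mixFun A x i = x.1 i := if_pos h

lemma mixFun_of_notMem {α : Type*} {A : Set ι} {i : ι} (h : i ∉ A) (x : (ι → α) × (ι → α)) :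
    mixFun A x i = x.2 i := if_neg h

lemma measurable_mixFun (A : Set ι) : Measurable (mixFun (α := α) A) := by
  classical
  refine measurable_pi_lambda _ fun i => ?_
  by_cases h : i ∈ A
  · simpa only [mixFun_of_mem h] using by fun_prop
  · simpa only [mixFun_of_notMem h] using by fun_prop

lemma measurePreserving_mixFun (A : Set ι) :
    MeasurePreserving (mixFun A)
      ((Measure.infinitePi fun _ : ι => μ).prod (Measure.infinitePi fun _ : ι => μ))
      (Measure.infinitePi fun _ : ι => μ) := by
  classical
  refine ⟨measurable_mixFun A, Measure.eq_infinitePi _ fun s t ht => ?_⟩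
  have hm : MeasurableSet (Set.pi (s : Set ι) t) :=
    MeasurableSet.pi s.countable_toSet fun i _ => ht i
  rw [Measure.map_apply (measurable_mixFun A) hm]
  have : mixFun A ⁻¹' (Set.pi (s : Set ι) t) =
      (Set.pi (↑(s.filter (· ∈ A))) t) ×ˢ (Set.pi (↑(s.filter (· ∉ A))) t) := by
    ext x
    simp only [Set.mem_preimage, Set.mem_pi, Set.mem_prod, Finset.coe_filter, Set.mem_ofPred_eq,
      Finset.mem_coe]
    constructor
    · intro h
      refine ⟨fun i hi => ?_, fun i hi => ?_⟩
      · have := h i hi.1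
        rwa [mixFun_of_mem hi.2] at this
      · have := h i hi.1
        rwa [mixFun_of_notMem hi.2] at this
    · rintro ⟨h1, h2⟩ i hi
      by_cases hA : i ∈ A
      · rw [mixFun_of_mem hA]; exact h1 i ⟨hi, hA⟩
      · rw [mixFun_of_notMem hA]; exact h2 i ⟨hi, hA⟩
  rw [this, Measure.prod_prod, Measure.infinitePi_pi _ (fun i _ => ht i),
    Measure.infinitePi_pi _ (fun i _ => ht i), Finset.prod_filter_mul_prod_filter_not]

lemma measurePreserving_comp_infinitePi {κ : Type*} {τ : κ → ι} (hτ : Function.Injective τ) :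
    MeasurePreserving (fun x : ι → α => x ∘ τ)
      (Measure.infinitePi fun _ : ι => μ) (Measure.infinitePi fun _ : κ => μ) := by
  classical
  have hmeas : Measurable (fun x : ι → α => x ∘ τ) :=
    measurable_pi_lambda _ fun i => measurable_pi_apply _
  refine ⟨hmeas, Measure.eq_infinitePi _ fun s t ht => ?_⟩
  have hm : MeasurableSet (Set.pi (s : Set κ) t) :=
    MeasurableSet.pi s.countable_toSet fun i _ => ht i
  rw [Measure.map_apply hmeas hm]
  let t' : ι → Set α := Function.extend τ t fun _ => Set.univ
  have ht' : ∀ i, t' (τ i) = t i := fun i => hτ.extend_apply _ _ _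
  have : (fun x : ι → α => x ∘ τ) ⁻¹' (Set.pi (s : Set κ) t) =
      Set.pi (↑(s.map ⟨τ, hτ⟩)) t' := by
    ext x
    simp [Set.mem_pi, ht']
  rw [this, Measure.infinitePi_pi, Finset.prod_map]
  · simp [ht']
  · intro i hi
    obtain ⟨j, _, rfl⟩ := Finset.mem_map.1 hi
    simpa [ht'] using ht j

end Product

/-- The points and the marks, without the number of points. -/
abbrev MarkedPoints (𝕏 : Type*) : Type _ := (ℕ → 𝕏) × (ℕ → ℕ → I)

/-- The law of the i.i.d. points and of the i.i.d. uniform marks. -/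
noncomputable def pointLaw {𝕏 : Type*} [MeasurableSpace 𝕏] (μ : Measure 𝕏) :
    Measure (MarkedPoints 𝕏) :=
  (Measure.infinitePi fun _ : ℕ => μ).prod
      (Measure.infinitePi fun _ : ℕ => Measure.infinitePi fun _ : ℕ => (volume : Measure I))

section PointLaw

variable {𝕏 : Type*} [MeasurableSpace 𝕏] (μ : Measure 𝕏) [IsProbabilityMeasure μ]

instance : IsProbabilityMeasure (pointLaw μ) := by
  unfold pointLaw; infer_instance

/-- The law of the points and marks, the marks being indexed by pairs. -/
noncomputable def pairLaw : Measure ((ℕ → 𝕏) × (ℕ × ℕ → I)) :=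
  (Measure.infinitePi fun _ : ℕ => μ).prod
    (Measure.infinitePi fun _ : ℕ × ℕ => (volume : Measure I))

instance : IsProbabilityMeasure (pairLaw μ) := by
  unfold pairLaw; infer_instance

lemma measurePreserving_curry_pairLaw :
    MeasurePreserving (Prod.map id Function.curry) (pairLaw μ) (pointLaw μ) := by
  refine (MeasurePreserving.id _).prod ⟨?_, ?_⟩
  · exact measurable_pi_lambda _ fun i => measurable_pi_lambda _ fun j => measurable_pi_apply _
  · exact Measure.infinitePi_map_curry fun _ _ => (volume : Measure I)

lemma measurePreserving_uncurry_pointLaw :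
    MeasurePreserving (Prod.map id Function.uncurry) (pointLaw μ) (pairLaw μ) := by
  refine (MeasurePreserving.id _).prod ⟨?_, ?_⟩
  · exact measurable_pi_lambda _ fun i =>
      (measurable_pi_apply i.2).comp (measurable_pi_apply i.1)
  · exact Measure.infinitePi_map_curry_symm fun _ _ => (volume : Measure I)

/-- Take the points with label in `A` and the marks with label in `B` from the first configuration,
the other ones from the second. -/
noncomputable def splice {𝕏 : Type*} (A : Set ℕ) (B : Set (ℕ × ℕ))
    (ω : MarkedPoints 𝕏 × MarkedPoints 𝕏) : MarkedPoints 𝕏 :=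
  (mixFun A (ω.1.1, ω.2.1),
    Function.curry (mixFun B (Function.uncurry ω.1.2, Function.uncurry ω.2.2)))

/-- Resampling device: quantities that read disjoint sets of points and marks can be evaluated on
two independent copies, so independence becomes Fubini. -/
lemma measurePreserving_splice (A : Set ℕ) (B : Set (ℕ × ℕ)) :
    MeasurePreserving (splice A B) ((pointLaw μ).prod (pointLaw μ)) (pointLaw μ) := by
  have hu := (measurePreserving_uncurry_pointLaw μ).prod (measurePreserving_uncurry_pointLaw μ)
  have hs : MeasurePreserving
      (fun z : ((ℕ → 𝕏) × (ℕ × ℕ → I)) × ((ℕ → 𝕏) × (ℕ × ℕ → I)) =>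
        ((z.1.1, z.2.1), (z.1.2, z.2.2)))
      ((pairLaw μ).prod (pairLaw μ))
      (((Measure.infinitePi fun _ : ℕ => μ).prod (Measure.infinitePi fun _ : ℕ => μ)).prod
        ((Measure.infinitePi fun _ : ℕ × ℕ => (volume : Measure I)).prod
        (Measure.infinitePi fun _ : ℕ × ℕ => (volume : Measure I)))) :=
    measurePreserving_prod_prod_swap _ _ _ _
  have hm := (measurePreserving_mixFun μ A).prod (measurePreserving_mixFun (volume : Measure I) B)
  exact (measurePreserving_curry_pairLaw μ).comp (hm.comp (hs.comp hu))

/-- Relabel points and marks. -/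
def relabel {𝕏 : Type*} (τ : ℕ → ℕ) (ω : MarkedPoints 𝕏) : MarkedPoints 𝕏 :=
  (ω.1 ∘ τ, fun i j => ω.2 (τ i) (τ j))

lemma measurePreserving_relabel {τ : ℕ → ℕ} (hτ : Function.Injective τ) :
    MeasurePreserving (relabel τ) (pointLaw μ) (pointLaw μ) := by
  have hm := (measurePreserving_comp_infinitePi μ hτ).prod
    (measurePreserving_comp_infinitePi (volume : Measure I) (hτ.prodMap hτ))
  exact (measurePreserving_curry_pairLaw μ).comp (hm.comp (measurePreserving_uncurry_pointLaw μ))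

lemma measurePreserving_point_mark (v i j : ℕ) :
    MeasurePreserving (fun ω : MarkedPoints 𝕏 => (ω.1 v, ω.2 i j)) (pointLaw μ)
      (μ.prod (volume : Measure I)) := by
  have h1 := measurePreserving_eval_infinitePi (fun _ : ℕ => μ) v
  have h2 := (measurePreserving_eval_infinitePi (fun _ : ℕ => (volume : Measure I)) j).comp
    (measurePreserving_eval_infinitePi
      (fun _ : ℕ => Measure.infinitePi fun _ : ℕ => (volume : Measure I)) i)
  exact h1.prod h2

end PointLaw

/-! ### The random graph on all labels, and counts over finite label sets -/

lemma SimpleGraph.connected_induce_comap_iff {V W : Type*} (G : SimpleGraph V) {f : W → V}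
    (hf : Function.Injective f) (S : Set W) :
    ((G.comap f).induce S).Connected ↔ (G.induce (f '' S)).Connected := by
  let e : (G.comap f).induce S ≃g G.induce (f '' S) :=
    { toEquiv := Equiv.Set.image f S hf
      map_rel_iff' := by intro a b; simp }
  exact e.connected_iff

section LabelGraph

variable {𝕏 : Type*}

/-- The random graph on all labels. -/
def labelGraph (φ : 𝕏 → 𝕏 → ℝ) (ω : MarkedPoints 𝕏) : SimpleGraph ℕ :=
  SimpleGraph.fromRel fun i j => i < j ∧ (ω.2 i j : ℝ) ≤ φ (ω.1 i) (ω.1 j)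

lemma labelGraph_adj_iff {φ : 𝕏 → 𝕏 → ℝ} {ω : MarkedPoints 𝕏} {v w : ℕ} (h : v ≠ w) :
    (labelGraph φ ω).Adj v w ↔
      (ω.2 (min v w) (max v w) : ℝ) ≤ φ (ω.1 (min v w)) (ω.1 (max v w)) := by
  rw [labelGraph, SimpleGraph.fromRel_adj]
  rcases h.lt_or_gt with h | h
  · simp [h.le, h, h.ne, h.not_gt]
  · simp [h.le, h, h.ne', h.not_gt]

/-- The labels in `S` induce a connected subgraph. -/
def ConnOn (φ : 𝕏 → 𝕏 → ℝ) (S : Finset ℕ) (ω : MarkedPoints 𝕏) : Prop :=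
  ((labelGraph φ ω).induce (S : Set ℕ)).Connected

open scoped Classical in
/-- The number of `k`-element subsets of `U` which induce a connected subgraph. -/
noncomputable def connCount (k : ℕ) (φ : 𝕏 → 𝕏 → ℝ) (U : Finset ℕ) (ω : MarkedPoints 𝕏) : ℕ :=
  ((U.powersetCard k).filter fun S => ConnOn φ S ω).card

lemma irgGraph_eq_comap (φ : 𝕏 → 𝕏 → ℝ) (ω : IRGSample 𝕏) :
    irgGraph φ ω = (labelGraph φ ω.2).comap (Fin.val : Fin ω.1 → ℕ) := by
  ext i j
  simp [irgGraph, labelGraph, Fin.ext_iff]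

lemma irgCount_eq_connCount (k : ℕ) (φ : 𝕏 → 𝕏 → ℝ) (ω : IRGSample 𝕏) :
    irgCount k φ ω = connCount k φ (Finset.range ω.1) ω.2 := by
  classical
  rw [irgCount, connInducedCount, connCount, ← Set.ncard_coe_finset]
  refine Set.ncard_congr (fun S _ => (S.toFinset.map Fin.valEmbedding)) ?_ ?_ ?_
  · rintro S ⟨hc, hS⟩
    simp only [Finset.coe_filter, Finset.mem_powersetCard, Set.mem_ofPred_eq, Finset.card_map]
    refine ⟨⟨?_, ?_⟩, ?_⟩
    · intro x hx
      obtain ⟨y, _, rfl⟩ := Finset.mem_map.1 hx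
      simp
    · rw [← hc, Set.ncard_eq_toFinset_card']
    · rw [irgGraph_eq_comap, SimpleGraph.connected_induce_comap_iff _ Fin.val_injective] at hS
      rw [ConnOn]
      convert hS using 2 <;> simp
  · intro S T _ _ h
    simpa using h
  · intro T hT
    simp only [Finset.coe_filter, Finset.mem_powersetCard, Set.mem_ofPred_eq] at hT
    obtain ⟨⟨hsub, hc⟩, hT⟩ := hT
    have himg : (Fin.val : Fin ω.1 → ℕ) '' (Fin.val ⁻¹' (T : Set ℕ)) = T := by
      rw [Set.image_preimage_eq_iff]
      intro x hx
      exact ⟨⟨x, Finset.mem_range.1 (hsub hx)⟩, rfl⟩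
    refine ⟨Fin.val ⁻¹' (T : Set ℕ), ⟨?_, ?_⟩, ?_⟩
    · rw [← Set.ncard_image_of_injective _ Fin.val_injective, himg, Set.ncard_coe_finset, hc]
    · rw [irgGraph_eq_comap, SimpleGraph.connected_induce_comap_iff _ Fin.val_injective, himg]
      exact hT
    · apply Finset.coe_injective
      simpa using himg

lemma connOn_congr {φ : 𝕏 → 𝕏 → ℝ} {S : Finset ℕ} {ω ω' : MarkedPoints 𝕏}
    (h1 : ∀ i ∈ S, ω.1 i = ω'.1 i) (h2 : ∀ i ∈ S, ∀ j ∈ S, ω.2 i j = ω'.2 i j) :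
    ConnOn φ S ω ↔ ConnOn φ S ω' := by
  have : (labelGraph φ ω).induce (S : Set ℕ) = (labelGraph φ ω').induce (S : Set ℕ) := by
    ext ⟨i, hi⟩ ⟨j, hj⟩
    simp only [SimpleGraph.comap_adj, labelGraph, SimpleGraph.fromRel_adj,
      Function.Embedding.subtype_apply]
    rw [h1 i hi, h1 j hj, h2 i hi j hj, h2 j hj i hi]
  rw [ConnOn, ConnOn, this]

lemma connOn_splice_left (φ : 𝕏 → 𝕏 → ℝ) {S : Finset ℕ} {A : Set ℕ} {B : Set (ℕ × ℕ)}
    (hA : ∀ i ∈ S, i ∈ A) (hB : ∀ i ∈ S, ∀ j ∈ S, (i, j) ∈ B)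
    (ω : MarkedPoints 𝕏 × MarkedPoints 𝕏) :
    ConnOn φ S (splice A B ω) ↔ ConnOn φ S ω.1 :=
  connOn_congr (fun i hi => mixFun_of_mem (hA i hi) _)
    fun i hi j hj => mixFun_of_mem (hB i hi j hj) _

lemma connOn_splice_right (φ : 𝕏 → 𝕏 → ℝ) {S : Finset ℕ} {A : Set ℕ} {B : Set (ℕ × ℕ)}
    (hA : ∀ i ∈ S, i ∉ A) (hB : ∀ i ∈ S, ∀ j ∈ S, (i, j) ∉ B)
    (ω : MarkedPoints 𝕏 × MarkedPoints 𝕏) :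
    ConnOn φ S (splice A B ω) ↔ ConnOn φ S ω.2 :=
  connOn_congr (fun i hi => mixFun_of_notMem (hA i hi) _)
    fun i hi j hj => mixFun_of_notMem (hB i hi j hj) _

/-- Monotonicity, and not just injectivity, matters: the edge between two labels reads only the mark
indexed in increasing order. -/
lemma connOn_relabel (φ : 𝕏 → 𝕏 → ℝ) (S : Finset ℕ) {τ : ℕ → ℕ} (hτ : StrictMono τ)
    (ω : MarkedPoints 𝕏) :
    ConnOn φ S (relabel τ ω) ↔ ConnOn φ (S.map ⟨τ, hτ.injective⟩) ω := by
  have : labelGraph φ (relabel τ ω) = (labelGraph φ ω).comap τ := by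
    ext i j
    simp [labelGraph, relabel, hτ.lt_iff_lt, hτ.injective.eq_iff]
  rw [ConnOn, ConnOn, this, SimpleGraph.connected_induce_comap_iff _ hτ.injective,
    Finset.coe_map, Function.Embedding.coeFn_mk]

lemma connCount_relabel (k : ℕ) (φ : 𝕏 → 𝕏 → ℝ) (U : Finset ℕ) {τ : ℕ → ℕ} (hτ : StrictMono τ)
    (ω : MarkedPoints 𝕏) :
    connCount k φ U (relabel τ ω) = connCount k φ (U.map ⟨τ, hτ.injective⟩) ω := by
  classical
  rw [connCount, connCount, Finset.powersetCard_map, Finset.filter_map, Finset.card_map]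
  congr 1
  ext S
  simp [connOn_relabel φ S hτ]

lemma connCount_congr {k : ℕ} {φ : 𝕏 → 𝕏 → ℝ} {U : Finset ℕ} {ω ω' : MarkedPoints 𝕏}
    (h : ∀ S ⊆ U, (ConnOn φ S ω ↔ ConnOn φ S ω')) :
    connCount k φ U ω = connCount k φ U ω' := by
  classical
  rw [connCount, connCount]
  congr 1
  exact Finset.filter_congr fun S hS => h S (Finset.mem_powersetCard.1 hS).1

lemma connCount_le_choose (k : ℕ) (φ : 𝕏 → 𝕏 → ℝ) (U : Finset ℕ) (ω : MarkedPoints 𝕏) :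
    connCount k φ U ω ≤ U.card.choose k := by
  classical
  rw [← Finset.card_powersetCard]
  exact Finset.card_filter_le _ _

lemma connCount_eq_sum_indicator (k : ℕ) (φ : 𝕏 → 𝕏 → ℝ) (U : Finset ℕ) (ω : MarkedPoints 𝕏) :
    connCount k φ U ω =
      ∑ S ∈ U.powersetCard k, {ω | ConnOn φ S ω}.indicator (fun _ => (1 : ℕ)) ω := by
  classical
  rw [connCount, Finset.card_filter]
  rfl

end LabelGraph

lemma exists_strictMono_map_range (U : Finset ℕ) :
    ∃ τ : ℕ → ℕ, ∃ hτ : StrictMono τ, (Finset.range U.card).map ⟨τ, hτ.injective⟩ = U := by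
  classical
  have hlt : ∀ i (h : i < U.card), U.orderEmbOfFin rfl ⟨i, h⟩ ≤ U.sup id := fun i h =>
    Finset.le_sup (f := id) (Finset.orderEmbOfFin_mem U rfl _)
  -- Beyond `U.card` the values exceed every element of `U`, which keeps `τ` strictly increasing on
  -- all of `ℕ`.
  let τ : ℕ → ℕ := fun i => if h : i < U.card then U.orderEmbOfFin rfl ⟨i, h⟩ else U.sup id + 1 + i
  have hτ : StrictMono τ := by
    intro i j hij
    simp only [τ]
    by_cases hj : j < U.card
    · simp [hj, hij.trans hj, hij]
    · by_cases hi : i < U.card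
      · have := hlt i hi
        simp only [hi, hj, dif_pos, dif_neg, not_false_eq_true]
        omega
      · simp only [hi, hj, dif_neg, not_false_eq_true]
        omega
  refine ⟨τ, hτ, Finset.eq_of_subset_of_card_le ?_ (by simp)⟩
  intro x hx
  obtain ⟨i, hi, rfl⟩ := Finset.mem_map.1 hx
  have hi' := Finset.mem_range.1 hi
  simp only [Function.Embedding.coeFn_mk, τ, hi', dif_pos]
  exact Finset.orderEmbOfFin_mem U rfl _

/-! ### Measurability -/

section Measurability

variable {𝕏 : Type*} [MeasurableSpace 𝕏]

/-- Connectedness depends only on a random relation on the finite set `S`, and every set of such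
relations is measurable. -/
lemma measurableSet_connOn {φ : 𝕏 → 𝕏 → ℝ} (hφ : Measurable (Function.uncurry φ))
    (S : Finset ℕ) : MeasurableSet {ω | ConnOn φ S ω} := by
  let r : MarkedPoints 𝕏 → (S → S → Prop) := fun ω i j =>
    (i : ℕ) < j ∧ (ω.2 i j : ℝ) ≤ φ (ω.1 i) (ω.1 j)
  have hr : Measurable r := by
    refine measurable_pi_lambda _ fun i => measurable_pi_lambda _ fun j => ?_
    refine Measurable.and measurable_const ?_
    refine measurableSet_setOfPred.1 (measurableSet_le ?_ ?_)
    · exact measurable_subtype_coe.comp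
        ((measurable_pi_apply (j : ℕ)).comp ((measurable_pi_apply (i : ℕ)).comp measurable_snd))
    · have hi : Measurable fun ω : MarkedPoints 𝕏 => ω.1 (i : ℕ) :=
        (measurable_pi_apply (i : ℕ)).comp measurable_fst
      have hj : Measurable fun ω : MarkedPoints 𝕏 => ω.1 (j : ℕ) :=
        (measurable_pi_apply (j : ℕ)).comp measurable_fst
      exact hφ.comp (hi.prodMk hj)
  have : {ω | ConnOn φ S ω} =
      r ⁻¹' {q | (SimpleGraph.fromRel q : SimpleGraph S).Connected} := by
    ext ω
    simp only [Set.mem_ofPred_eq, Set.mem_preimage, ConnOn]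
    have : (labelGraph φ ω).induce (S : Set ℕ) = (SimpleGraph.fromRel (r ω) : SimpleGraph S) := by
      ext i j
      simp only [labelGraph, r, SimpleGraph.comap_adj, SimpleGraph.fromRel_adj, ne_eq,
        Function.Embedding.subtype_apply, Subtype.ext_iff]
    rw [this]
  rw [this]
  exact hr (Set.Finite.measurableSet (Set.toFinite _))

lemma measurable_connCount (k : ℕ) {φ : 𝕏 → 𝕏 → ℝ} (hφ : Measurable (Function.uncurry φ))
    (U : Finset ℕ) : Measurable (connCount k φ U) := by
  have : connCount k φ U = fun ω =>
      ∑ S ∈ U.powersetCard k, {ω | ConnOn φ S ω}.indicator (fun _ => (1 : ℕ)) ω :=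
    funext fun ω => connCount_eq_sum_indicator k φ U ω
  rw [this]
  exact Finset.measurable_sum _ fun S _ =>
    measurable_const.indicator (measurableSet_connOn hφ S)

lemma measurable_irgCount (k : ℕ) {φ : 𝕏 → 𝕏 → ℝ} (hφ : Measurable (Function.uncurry φ)) :
    Measurable (irgCount k φ) := by
  have : irgCount k φ = fun ω => connCount k φ (Finset.range ω.1) ω.2 :=
    funext fun ω => irgCount_eq_connCount k φ ω
  rw [this]
  exact measurable_from_prod_countable_right fun n =>
    measurable_connCount k hφ (Finset.range n)

end Measurability

/-! ### Connection probabilities: attaching and removing one vertex -/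

section Extension

variable {𝕏 : Type*} [MeasurableSpace 𝕏] {μ : Measure 𝕏} [IsProbabilityMeasure μ] {φ : 𝕏 → 𝕏 → ℝ}

lemma IsConnectionFunction.integrable (hφ : IsConnectionFunction φ) (x : 𝕏) :
    Integrable (φ x) μ := by
  refine Integrable.of_bound (C := 1)
    (hφ.measurable.comp measurable_prodMk_left).aestronglyMeasurable ?_
  refine ae_of_all _ fun y => ?_
  simpa [abs_of_nonneg (hφ.nonneg x y)] using hφ.le_one x y

lemma pointLaw_mark_le (hφ : IsConnectionFunction φ) (x : 𝕏) (v i j : ℕ) :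
    pointLaw μ {ω | (ω.2 i j : ℝ) ≤ φ x (ω.1 v)} = ENNReal.ofReal (∫ y, φ x y ∂μ) := by
  have hφx : Measurable (φ x) := hφ.measurable.comp measurable_prodMk_left
  have hm : MeasurableSet {z : 𝕏 × I | (z.2 : ℝ) ≤ φ x z.1} :=
    measurableSet_le (measurable_subtype_coe.comp measurable_snd) (hφx.comp measurable_fst)
  have := (measurePreserving_point_mark μ v i j).measure_preimage hm.nullMeasurableSet
  simp only [Set.preimage_ofPred_eq] at this
  rw [this, Measure.prod_apply hm, ofReal_integral_eq_lintegral_ofReal (hφ.integrable x)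
    (ae_of_all _ (hφ.nonneg x))]
  refine lintegral_congr fun y => ?_
  have : Prod.mk y ⁻¹' {z : 𝕏 × I | (z.2 : ℝ) ≤ φ x z.1} =
      Set.Iic (⟨φ x y, hφ.nonneg x y, hφ.le_one x y⟩ : I) := by
    ext u
    simp [← Subtype.coe_le_coe]
  rw [this, unitInterval.volume_Iic]

lemma measurableSet_adj (hφ : Measurable (Function.uncurry φ)) {v w : ℕ} (h : v ≠ w) :
    MeasurableSet {ω : MarkedPoints 𝕏 | (labelGraph φ ω).Adj v w} := by
  simp only [labelGraph_adj_iff h]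
  have hx (i : ℕ) : Measurable fun ω : MarkedPoints 𝕏 => ω.1 i :=
    (measurable_pi_apply i).comp measurable_fst
  refine measurableSet_le ?_ ?_
  · exact measurable_subtype_coe.comp
      ((measurable_pi_apply _).comp ((measurable_pi_apply _).comp measurable_snd))
  · exact hφ.comp ((hx _).prodMk (hx _))

/-- The connectedness of `V` does not read the point `v` or the mark of the pair `{v, w}`.
Resampling just these two gives the edge the conditional probability `∫ φ(X_w, y) μ(dy)`. -/
lemma pointLaw_connOn_and_adj (hφ : IsConnectionFunction φ) {V : Finset ℕ} {v w : ℕ}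
    (hv : v ∉ V) (hw : w ∈ V) :
    pointLaw μ {ω | ConnOn φ V ω ∧ (labelGraph φ ω).Adj v w} =
      ∫⁻ ω in {ω | ConnOn φ V ω}, ENNReal.ofReal (∫ y, φ (ω.1 w) y ∂μ) ∂(pointLaw μ) := by
  classical
  have hvw : v ≠ w := fun h => hv (h ▸ hw)
  have hc := measurableSet_connOn hφ.measurable V
  have hm : MeasurableSet {ω | ConnOn φ V ω ∧ (labelGraph φ ω).Adj v w} :=
    hc.inter (measurableSet_adj hφ.measurable hvw)
  have hpres := measurePreserving_splice μ {v} {(min v w, max v w)}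
  rw [← hpres.measure_preimage hm.nullMeasurableSet,
    Measure.prod_apply_symm (hpres.measurable hm), ← lintegral_indicator hc]
  refine lintegral_congr fun ω' => ?_
  have key : ∀ ω : MarkedPoints 𝕏, (splice {v} {(min v w, max v w)} (ω, ω') ∈
      {ω | ConnOn φ V ω ∧ (labelGraph φ ω).Adj v w}) ↔
      (ConnOn φ V ω' ∧ (ω.2 (min v w) (max v w) : ℝ) ≤ φ (ω'.1 w) (ω.1 v)) := by
    intro ω
    rw [Set.mem_ofPred_eq, connOn_splice_right, labelGraph_adj_iff hvw]
    · refine and_congr_right fun _ => ?_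
      generalize hζ : splice {v} {(min v w, max v w)} (ω, ω') = ζ
      have h1 : ζ.2 (min v w) (max v w)
          = ω.2 (min v w) (max v w) := hζ ▸ mixFun_of_mem (Set.mem_singleton _) _
      have h2 : ζ.1 v = ω.1 v :=
        hζ ▸ mixFun_of_mem (Set.mem_singleton _) _
      have h3 : ζ.1 w = ω'.1 w :=
        hζ ▸ mixFun_of_notMem (fun h => hvw (Set.mem_singleton_iff.1 h).symm) _
      rw [h1]
      rcases hvw.lt_or_gt with h | h
      · rw [min_eq_left h.le, max_eq_right h.le, h2, h3, hφ.symm]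
      · rw [min_eq_right h.le, max_eq_left h.le, h2, h3]
    · rintro i hi rfl
      exact hv hi
    · intro i hi j hj h
      obtain ⟨rfl, rfl⟩ := Prod.mk.inj (Set.mem_singleton_iff.1 h)
      rcases hvw.lt_or_gt with h | h
      · exact hv (by simpa [h.le] using hi)
      · exact hv (by simpa [h.le] using hj)
  by_cases hω' : ConnOn φ V ω'
  · rw [Set.indicator_of_mem (show ω' ∈ {ω | ConnOn φ V ω} from hω'), ← pointLaw_mark_le hφ (ω'.1 w) v (min v w) (max v w)]
    congr 1
    ext ω
    exact (key ω).trans (and_iff_right hω')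
  · rw [Set.indicator_of_notMem (show ω' ∉ {ω | ConnOn φ V ω} from hω')]
    convert measure_empty (μ := pointLaw μ)
    ext ω
    exact (key ω).trans (by simp [hω'])

lemma pointLaw_connOn_and_adj_le (hφ : IsConnectionFunction φ) {p : ℝ} (hp : ∀ x, ∫ y, φ x y ∂μ ≤ p)
    {V : Finset ℕ} {v w : ℕ} (hv : v ∉ V) (hw : w ∈ V) :
    pointLaw μ {ω | ConnOn φ V ω ∧ (labelGraph φ ω).Adj v w} ≤
      ENNReal.ofReal p * pointLaw μ {ω | ConnOn φ V ω} := by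
  rw [pointLaw_connOn_and_adj hφ hv hw, ← setLIntegral_const]
  exact lintegral_mono fun ω => ENNReal.ofReal_le_ofReal (hp _)

lemma le_pointLaw_connOn_and_adj (hφ : IsConnectionFunction φ) {a : ℝ} (ha : ∀ x, a ≤ ∫ y, φ x y ∂μ)
    {V : Finset ℕ} {v w : ℕ} (hv : v ∉ V) (hw : w ∈ V) :
    ENNReal.ofReal a * pointLaw μ {ω | ConnOn φ V ω} ≤
      pointLaw μ {ω | ConnOn φ V ω ∧ (labelGraph φ ω).Adj v w} := by
  rw [pointLaw_connOn_and_adj hφ hv hw, ← setLIntegral_const]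
  exact lintegral_mono fun ω => ENNReal.ofReal_le_ofReal (ha _)

end Extension

section Connectivity

variable {𝕏 : Type*} {φ : 𝕏 → 𝕏 → ℝ}

lemma connOn_singleton (φ : 𝕏 → 𝕏 → ℝ) (v : ℕ) (ω : MarkedPoints 𝕏) : ConnOn φ {v} ω := by
  rw [ConnOn, Finset.coe_singleton]
  exact SimpleGraph.Connected.of_subsingleton

lemma ConnOn.nonempty {S : Finset ℕ} {ω : MarkedPoints 𝕏} (h : ConnOn φ S ω) : S.Nonempty := by
  obtain ⟨x⟩ := SimpleGraph.Connected.nonempty h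
  exact ⟨x, x.2⟩

lemma ConnOn.union {S T : Finset ℕ} {ω : MarkedPoints 𝕏} (hS : ConnOn φ S ω) (hT : ConnOn φ T ω)
    (h : ¬ Disjoint S T) : ConnOn φ (S ∪ T) ω := by
  rw [ConnOn, Finset.coe_union]
  refine SimpleGraph.induce_union_connected
    (SimpleGraph.Connected.preconnected hS) (SimpleGraph.Connected.preconnected hT) ?_
  rw [Finset.not_disjoint_iff] at h
  exact h

lemma ConnOn.insert {V : Finset ℕ} {v w : ℕ} {ω : MarkedPoints 𝕏} (hV : ConnOn φ V ω) (hw : w ∈ V)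
    (h : (labelGraph φ ω).Adj v w) : ConnOn φ (Insert.insert v V) ω := by
  have h2 : ConnOn φ {v, w} ω := by
    rw [ConnOn, Finset.coe_pair]
    exact SimpleGraph.induce_pair_connected_of_adj h
  have : Insert.insert v V = {v, w} ∪ V := by
    ext x; simp only [Finset.mem_insert, Finset.mem_union, Finset.mem_singleton]
    constructor
    · rintro (h | h) <;> simp [h]
    · rintro ((h | rfl) | h) <;> simp [*]
  rw [this]
  exact h2.union hV (Finset.not_disjoint_iff.2 ⟨w, by simp, hw⟩)

/-- A finite connected graph with at least two vertices has a non-cut vertex, and that vertex has a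
neighbour. This drives the induction for the upper bound. -/
lemma ConnOn.exists_erase {V : Finset ℕ} {ω : MarkedPoints 𝕏} (hV : ConnOn φ V ω)
    (hc : 1 < V.card) :
    ∃ v ∈ V, ∃ w ∈ V.erase v, ConnOn φ (V.erase v) ω ∧ (labelGraph φ ω).Adj v w := by
  have : Nontrivial (V : Set ℕ) := 
    Set.nontrivial_coe_sort.2 (Finset.one_lt_card_iff_nontrivial.1 hc)
  obtain ⟨v, hv⟩ :=
    SimpleGraph.Connected.exists_connected_induce_compl_singleton_of_finite_nontrivial hV
  obtain ⟨w, hw⟩ := SimpleGraph.Preconnected.exists_adj_of_nontrivial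
    (SimpleGraph.Connected.preconnected hV) v
  refine ⟨v, v.2, w, ?_, ?_, hw⟩
  · exact Finset.mem_erase.2 ⟨fun h => hw.ne (Subtype.ext h).symm, w.2⟩
  · replace hv := (SimpleGraph.connected_induce_comap_iff (labelGraph φ ω)
      (f := fun x : ↥(V : Set ℕ) => x.1) Subtype.val_injective _).1 hv
    have himg : ((V.erase v : Finset ℕ) : Set ℕ) = (fun x : ↥(V : Set ℕ) => x.1) '' {v}ᶜ := by
      ext x
      constructor
      · intro hx
        obtain ⟨hne, hx⟩ := Finset.mem_erase.1 (Finset.mem_coe.1 hx)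
        exact ⟨⟨x, hx⟩, fun h => hne (congrArg Subtype.val h), rfl⟩
      · rintro ⟨y, hy, rfl⟩
        exact Finset.mem_coe.2 (Finset.mem_erase.2 ⟨fun h => hy (Subtype.ext h), y.2⟩)
    rw [ConnOn, himg]
    exact hv

end Connectivity

section Bounds

variable {𝕏 : Type*} [MeasurableSpace 𝕏] {μ : Measure 𝕏} [IsProbabilityMeasure μ] {φ : 𝕏 → 𝕏 → ℝ}

/-- Union bound over the removed non-cut vertex and its neighbour: each removal costs a factor `p`
and at most the square of the current number of vertices. -/
lemma pointLaw_connOn_le (hφ : IsConnectionFunction φ) {p : ℝ} (hp : ∀ x, ∫ y, φ x y ∂μ ≤ p)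
    (m : ℕ) : ∀ V : Finset ℕ, V.card = m + 1 → pointLaw μ {ω | ConnOn φ V ω} ≤
      (((m + 1) ^ 2 : ℕ) * ENNReal.ofReal p) ^ m := by
  induction m with
  | zero => intro V _; simpa using prob_le_one
  | succ m ih =>
    intro V hV
    have hsub : {ω | ConnOn φ V ω} ⊆ ⋃ v ∈ V, ⋃ w ∈ V.erase v,
        {ω | ConnOn φ (V.erase v) ω ∧ (labelGraph φ ω).Adj v w} := by
      intro ω hω
      obtain ⟨v, hv, w, hw, h⟩ := ConnOn.exists_erase (V := V) hω (by omega)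
      simp only [Set.mem_iUnion]
      exact ⟨v, hv, w, hw, h⟩
    calc pointLaw μ {ω | ConnOn φ V ω}
        ≤ ∑ v ∈ V, ∑ w ∈ V.erase v, pointLaw μ
            {ω | ConnOn φ (V.erase v) ω ∧ (labelGraph φ ω).Adj v w} :=
          (measure_mono hsub).trans <| (measure_biUnion_finset_le _ _).trans <|
            Finset.sum_le_sum fun v _ => measure_biUnion_finset_le _ _
      _ ≤ ∑ v ∈ V, ∑ w ∈ V.erase v, ENNReal.ofReal p *
            (((m + 1) ^ 2 : ℕ) * ENNReal.ofReal p) ^ m := by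
          refine Finset.sum_le_sum fun v hv => Finset.sum_le_sum fun w hw => ?_
          refine (pointLaw_connOn_and_adj_le hφ hp (Finset.notMem_erase v V) hw).trans ?_
          gcongr
          exact ih _ (by rw [Finset.card_erase_of_mem hv, hV]; rfl)
      _ ≤ ∑ v ∈ V, ∑ w ∈ V, ENNReal.ofReal p *
            (((m + 1 + 1) ^ 2 : ℕ) * ENNReal.ofReal p) ^ m := by
          refine Finset.sum_le_sum fun v hv => ?_
          refine (Finset.sum_le_sum_of_subset (Finset.erase_subset v V)).trans ?_
          gcongr
          omega
      _ = (((m + 1 + 1) ^ 2 : ℕ) * ENNReal.ofReal p) ^ (m + 1) := by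
          simp only [Finset.sum_const, hV, nsmul_eq_mul, pow_succ _ m]
          push_cast
          ring

/-- Each new label is attached to label `0`; a star is enough for connectedness. -/
lemma le_pointLaw_connOn_range (hφ : IsConnectionFunction φ) {a : ℝ}
    (ha : ∀ x, a ≤ ∫ y, φ x y ∂μ) (m : ℕ) :
    ENNReal.ofReal a ^ m ≤ pointLaw μ {ω | ConnOn φ (Finset.range (m + 1)) ω} := by
  induction m with
  | zero =>
    have : {ω : MarkedPoints 𝕏 | ConnOn φ (Finset.range (0 + 1)) ω} = Set.univ :=
      Set.eq_univ_of_forall fun ω => by simpa using connOn_singleton φ 0 ω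
    rw [this]
    simp
  | succ m ih =>
    rw [pow_succ']
    refine (mul_le_mul_right ih _).trans ?_
    refine (le_pointLaw_connOn_and_adj hφ ha (v := m + 1) (w := 0) (by simp) (by simp)).trans ?_
    refine measure_mono fun ω hω => ?_
    rw [Set.mem_ofPred_eq, Finset.range_add_one]
    exact ConnOn.insert hω.1 (by simp) hω.2

/-- The probability that `k` given labels induce a connected subgraph. -/
noncomputable def connProb (μ : Measure 𝕏) (φ : 𝕏 → 𝕏 → ℝ) (k : ℕ) : ℝ :=
  (pointLaw μ).real {ω | ConnOn φ (Finset.range k) ω}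

/-- Exchangeability: the increasing relabelling of `S` by an initial segment preserves the law. -/
lemma pointLaw_real_connOn (hφ : Measurable (Function.uncurry φ)) (S : Finset ℕ) :
    (pointLaw μ).real {ω | ConnOn φ S ω} = connProb μ φ S.card := by
  obtain ⟨τ, hτ, h⟩ := exists_strictMono_map_range S
  rw [connProb]
  conv_rhs => rw [← (measurePreserving_relabel μ hτ.injective).measureReal_preimage
      (measurableSet_connOn hφ _).nullMeasurableSet]
  congr 1
  ext ω
  rw [Set.mem_preimage, Set.mem_ofPred_eq, Set.mem_ofPred_eq, connOn_relabel φ _ hτ, h]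

lemma connProb_le (hφ : IsConnectionFunction φ) {p : ℝ} (hp0 : 0 ≤ p)
    (hp : ∀ x, ∫ y, φ x y ∂μ ≤ p) (m : ℕ) :
    connProb μ φ (m + 1) ≤ ((m + 1) ^ 2 * p) ^ m := by
  refine ENNReal.toReal_le_of_le_ofReal (by positivity) ?_
  refine (pointLaw_connOn_le hφ hp m _ (by simp)).trans_eq ?_
  rw [ENNReal.ofReal_pow (by positivity), ENNReal.ofReal_mul (by positivity)]
  congr 2
  rw [← ENNReal.ofReal_natCast]
  push_cast
  rfl

lemma le_connProb (hφ : IsConnectionFunction φ) {a : ℝ} (ha0 : 0 ≤ a)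
    (ha : ∀ x, a ≤ ∫ y, φ x y ∂μ) (m : ℕ) : a ^ m ≤ connProb μ φ (m + 1) := by
  refine (ENNReal.ofReal_le_iff_le_toReal (measure_ne_top _ _)).1 ?_
  rw [ENNReal.ofReal_pow ha0]
  exact le_pointLaw_connOn_range hφ ha m

end Bounds

lemma connProb_nonneg {𝕏 : Type*} [MeasurableSpace 𝕏] (μ : Measure 𝕏) (φ : 𝕏 → 𝕏 → ℝ) (k : ℕ) :
    0 ≤ connProb μ φ k := measureReal_nonneg

lemma norm_exp_mul_I_sub_exp_mul_I_le (a b : ℝ) :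
    ‖Complex.exp (a * Complex.I) - Complex.exp (b * Complex.I)‖ ≤ |a - b| := by
  have h : Complex.exp (a * Complex.I) - Complex.exp (b * Complex.I) =
      Complex.exp (b * Complex.I) * (Complex.exp (Complex.I * ((a - b : ℝ) : ℂ)) - 1) := by
    rw [mul_sub, ← Complex.exp_add, mul_one]
    congr 2
    push_cast
    ring
  rw [h, norm_mul, Complex.norm_exp_ofReal_mul_I, one_mul]
  simpa using Real.norm_exp_I_mul_ofReal_sub_one_le (x := a - b)

/-! ### Overlapping pairs and the decomposition of the count -/

section Counting

/-- Sums over overlapping pairs of distinct `k`-subsets, organised by the union of the pair. -/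
lemma sum_overlapping_pairs_le {α : Type*} [DecidableEq α] (U : Finset α) (k : ℕ) {b : ℕ → ℝ}
    (hb : ∀ m, 0 ≤ b m) :
    ∑ S ∈ U.powersetCard k, ∑ T ∈ (U.powersetCard k).filter (fun T => T ≠ S ∧ ¬ Disjoint S T),
      b (S ∪ T).card ≤ ∑ m ∈ Finset.Ioo k (2 * k), (U.card.choose m : ℝ) * (4 ^ m * b m) := by
  classical
  let P : Finset (Finset α × Finset α) := ((U.powersetCard k) ×ˢ (U.powersetCard k)).filter
    fun z => z.2 ≠ z.1 ∧ ¬ Disjoint z.1 z.2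
  have hP : ∑ S ∈ U.powersetCard k,
      ∑ T ∈ (U.powersetCard k).filter (fun T => T ≠ S ∧ ¬ Disjoint S T), b (S ∪ T).card
      = ∑ z ∈ P, b (z.1 ∪ z.2).card := by
    simp only [P, Finset.sum_filter, Finset.sum_product]
  let V : Finset (Finset α) := U.powerset.filter fun V => V.card ∈ Finset.Ioo k (2 * k)
  have hPV : ∀ z ∈ P, z.1 ∪ z.2 ∈ V := by
    intro z hz
    simp only [P, Finset.mem_filter, Finset.mem_product, Finset.mem_powersetCard] at hz
    obtain ⟨⟨⟨h1, c1⟩, h2, c2⟩, hne, hd⟩ := hz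
    simp only [V, Finset.mem_filter, Finset.mem_powerset, Finset.mem_Ioo]
    refine ⟨Finset.union_subset h1 h2, ?_, ?_⟩
    -- Distinct `k`-sets have a union larger than `k`; sets that meet have a union smaller than
    -- `2k`.
    · by_contra! hle
      have e1 : z.1 = z.1 ∪ z.2 :=
        Finset.eq_of_subset_of_card_le Finset.subset_union_left (by omega)
      have e2 : z.2 = z.1 ∪ z.2 :=
        Finset.eq_of_subset_of_card_le Finset.subset_union_right (by omega)
      exact hne (e2.trans e1.symm)
    · have := Finset.card_union_add_card_inter z.1 z.2
      have hi : 0 < (z.1 ∩ z.2).card := by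
        rw [Finset.card_pos, Finset.nonempty_iff_ne_empty]
        exact fun h => hd (Finset.disjoint_iff_inter_eq_empty.2 h)
      omega
  rw [hP, ← Finset.sum_fiberwise_of_maps_to hPV]
  have hV : ∀ W ∈ V, W.card ∈ Finset.Ioo k (2 * k) := fun W hW => (Finset.mem_filter.1 hW).2
  calc ∑ W ∈ V, ∑ z ∈ P with z.1 ∪ z.2 = W, b (z.1 ∪ z.2).card
      ≤ ∑ W ∈ V, 4 ^ W.card * b W.card := by
        refine Finset.sum_le_sum fun W _ => ?_
        have hsub : (P.filter fun z => z.1 ∪ z.2 = W) ⊆ W.powerset ×ˢ W.powerset := by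
          intro z hz
          obtain ⟨_, rfl⟩ := Finset.mem_filter.1 hz
          exact Finset.mem_product.2 ⟨Finset.mem_powerset.2 Finset.subset_union_left,
            Finset.mem_powerset.2 Finset.subset_union_right⟩
        rw [Finset.sum_congr rfl fun z hz => by rw [(Finset.mem_filter.1 hz).2],
          Finset.sum_const, nsmul_eq_mul]
        -- A pair with union `W` consists of two subsets of `W`, so there are at most `(2 * 2) ^
        -- W.card` of them.
        refine mul_le_mul_of_nonneg_right ?_ (hb _)
        have := Finset.card_le_card hsub
        rw [Finset.card_product, Finset.card_powerset, ← mul_pow] at this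
        exact_mod_cast this
    _ = ∑ m ∈ Finset.Ioo k (2 * k), ∑ W ∈ V with W.card = m, 4 ^ W.card * b W.card :=
        (Finset.sum_fiberwise_of_maps_to hV _).symm
    _ ≤ _ := by
        refine Finset.sum_le_sum fun m _ => ?_
        rw [Finset.sum_congr rfl fun z hz => by rw [(Finset.mem_filter.1 hz).2],
          Finset.sum_const, nsmul_eq_mul]
        refine mul_le_mul_of_nonneg_right ?_ (mul_nonneg (by positivity) (hb _))
        rw [← Finset.card_powersetCard]
        refine Nat.cast_le.2 (Finset.card_le_card fun W hW => ?_)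
        simp only [V, Finset.mem_filter, Finset.mem_powerset] at hW
        exact Finset.mem_powersetCard.2 ⟨hW.1.1, hW.2⟩

end Counting

section Decomposition

variable {𝕏 : Type*} {φ : 𝕏 → 𝕏 → ℝ}

/-- The `k`-sets split into `S` itself, those disjoint from `S` and those overlapping it. Positivity
of `k` keeps `S` out of the disjoint class. -/
lemma connCount_eq_add (k : ℕ) {U S : Finset ℕ} (hS : S ∈ U.powersetCard k) (hk : 0 < k)
    {ω : MarkedPoints 𝕏} (h : ConnOn φ S ω) :
    (connCount k φ U ω : ℝ) = 1 + connCount k φ (U \ S) ω +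
      ∑ T ∈ (U.powersetCard k).filter (fun T => T ≠ S ∧ ¬ Disjoint S T),
        {ω | ConnOn φ T ω}.indicator (fun _ => (1 : ℝ)) ω := by
  classical
  have hcast : ∀ U : Finset ℕ, (connCount k φ U ω : ℝ) =
      ∑ T ∈ U.powersetCard k, {ω | ConnOn φ T ω}.indicator (fun _ => (1 : ℝ)) ω := by
    intro U
    rw [connCount_eq_sum_indicator]
    push_cast
    refine Finset.sum_congr rfl fun T _ => ?_
    simp only [Set.indicator_apply]
    split_ifs <;> simp
  rw [hcast, hcast]
  have hScard := (Finset.mem_powersetCard.1 hS).2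
  have hSne : S.Nonempty := Finset.card_pos.1 (by omega)
  have h1 : (U.powersetCard k).filter (fun T => ¬ (T ≠ S ∧ ¬ Disjoint S T)) =
      insert S ((U \ S).powersetCard k) := by
    ext T
    simp only [Finset.mem_filter, Finset.mem_insert, Finset.mem_powersetCard]
    constructor
    · rintro ⟨⟨hT, hc⟩, hn⟩
      by_cases hTS : T = S
      · exact Or.inl hTS
      · refine Or.inr ⟨?_, hc⟩
        have hd : Disjoint S T := by
          by_contra hd
          exact hn ⟨hTS, hd⟩
        exact Finset.subset_sdiff.2 ⟨hT, hd.symm⟩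
    · rintro (rfl | ⟨hT, hc⟩)
      · exact ⟨Finset.mem_powersetCard.1 hS, fun hn => hn.1 rfl⟩
      · obtain ⟨hTU, hd⟩ := Finset.subset_sdiff.1 hT
        exact ⟨⟨hTU, hc⟩, fun hn => hn.2 hd.symm⟩
  rw [← Finset.sum_filter_not_add_sum_filter (U.powersetCard k)
    (fun T => T ≠ S ∧ ¬ Disjoint S T), h1, Finset.sum_insert]
  · rw [Set.indicator_of_mem (show ω ∈ {ω | ConnOn φ S ω} from h)]
  · intro hm
    have := (Finset.subset_sdiff.1 (Finset.mem_powersetCard.1 hm).1).2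
    exact hSne.ne_empty (Finset.disjoint_self_iff_empty S |>.1 this)

/-- The two phases differ by `t` times the number of overlapping connected sets, and `x ↦ exp(ix)`
is 1-Lipschitz. If `S` and an overlapping `T` are both connected, so is `S ∪ T`. -/
lemma norm_indicator_mul_exp_sub_le (k : ℕ) {U S : Finset ℕ} (hS : S ∈ U.powersetCard k)
    (hk : 0 < k) (t : ℝ) (ω : MarkedPoints 𝕏) :
    ‖{ω | ConnOn φ S ω}.indicator (fun _ => (1 : ℂ)) ω *
        Complex.exp ((t * connCount k φ U ω : ℝ) * Complex.I) -
      Complex.exp (t * Complex.I) * ({ω | ConnOn φ S ω}.indicator (fun _ => (1 : ℂ)) ω *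
        Complex.exp ((t * connCount k φ (U \ S) ω : ℝ) * Complex.I))‖ ≤
    |t| * ∑ T ∈ (U.powersetCard k).filter (fun T => T ≠ S ∧ ¬ Disjoint S T),
        {ω | ConnOn φ (S ∪ T) ω}.indicator (fun _ => (1 : ℝ)) ω := by
  classical
  by_cases h : ω ∈ {ω | ConnOn φ S ω}
  · rw [Set.indicator_of_mem h, one_mul, one_mul, ← Complex.exp_add, ← add_mul]
    have := norm_exp_mul_I_sub_exp_mul_I_le (t * connCount k φ U ω)
      (t + t * connCount k φ (U \ S) ω)
    rw [Complex.ofReal_add t] at this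
    refine this.trans ?_
    rw [connCount_eq_add k hS hk h]
    have e : ∀ x y : ℝ, t * (1 + x + y) - (t + t * x) = t * y := fun x y => by ring
    rw [e, abs_mul, abs_of_nonneg (a := Finset.sum _ _) (Finset.sum_nonneg fun T _ =>
      Set.indicator_nonneg (fun _ _ => zero_le_one) _)]
    refine mul_le_mul_of_nonneg_left (Finset.sum_le_sum fun T hT => ?_) (abs_nonneg t)
    simp only [Set.indicator_apply]
    by_cases hT' : ω ∈ {ω | ConnOn φ T ω}
    · rw [if_pos hT', if_pos]
      exact ConnOn.union h hT' (Finset.mem_filter.1 hT).2.2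
    · rw [if_neg hT']
      split_ifs <;> norm_num
  · rw [Set.indicator_of_notMem h]
    simp only [zero_mul, mul_zero, sub_zero, norm_zero]
    exact mul_nonneg (abs_nonneg t) (Finset.sum_nonneg fun T _ =>
      Set.indicator_nonneg (fun _ _ => zero_le_one) _)

end Decomposition

/-! ### The approximate differential equation for a fixed number of points -/

section FixedNumber

variable {𝕏 : Type*} [MeasurableSpace 𝕏] {μ : Measure 𝕏} [IsProbabilityMeasure μ] {φ : 𝕏 → 𝕏 → ℝ}

/-- The characteristic function of the number of connected `k`-subsets of `U`. -/
noncomputable def connCharFun (μ : Measure 𝕏) (k : ℕ) (φ : 𝕏 → 𝕏 → ℝ) (U : Finset ℕ) (t : ℝ) : ℂ :=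
  ∫ ω, Complex.exp ((t * connCount k φ U ω : ℝ) * Complex.I) ∂(pointLaw μ)

lemma measurable_exp_connCount (k : ℕ) (hφ : Measurable (Function.uncurry φ)) (U : Finset ℕ)
    (t : ℝ) : Measurable fun ω : MarkedPoints 𝕏 =>
      Complex.exp ((t * connCount k φ U ω : ℝ) * Complex.I) := by
  have := measurable_connCount k hφ U
  have h2 : Measurable fun ω : MarkedPoints 𝕏 => (connCount k φ U ω : ℝ) :=
    measurable_from_top.comp this
  fun_prop

lemma connCharFun_eq (k : ℕ) (hφ : Measurable (Function.uncurry φ)) (U : Finset ℕ) (t : ℝ) :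
    connCharFun μ k φ U t = connCharFun μ k φ (Finset.range U.card) t := by
  obtain ⟨τ, hτ, h⟩ := exists_strictMono_map_range U
  have hp := measurePreserving_relabel μ hτ.injective
  conv_rhs => rw [connCharFun, ← hp.map_eq]
  rw [integral_map hp.measurable.aemeasurable
    (measurable_exp_connCount k hφ _ t).aestronglyMeasurable, connCharFun]
  simp only [connCount_relabel k φ _ hτ, h]

lemma norm_connCharFun_le (k : ℕ) (U : Finset ℕ) (t : ℝ) : ‖connCharFun μ k φ U t‖ ≤ 1 := by
  refine (norm_integral_le_of_norm_le_const (C := 1) (ae_of_all _ fun ω => ?_)).trans ?_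
  · exact (Complex.norm_exp_ofReal_mul_I _).le
  · simp

/-- Splicing along `S` lets the indicator read the first copy and the count on `U` the second, so
the integral factorises. -/
lemma integral_indicator_connOn_mul_exp (k : ℕ) (hφ : Measurable (Function.uncurry φ))
    {S U : Finset ℕ} (h : Disjoint S U) (t : ℝ) :
    ∫ ω, {ω | ConnOn φ S ω}.indicator (fun _ => (1 : ℂ)) ω *
      Complex.exp ((t * connCount k φ U ω : ℝ) * Complex.I) ∂(pointLaw μ) =
    connProb μ φ S.card * connCharFun μ k φ (Finset.range U.card) t := by
  classical
  have hmS := measurableSet_connOn hφ S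
  have hp := measurePreserving_splice μ (S : Set ℕ) ((S : Set ℕ) ×ˢ (S : Set ℕ))
  conv_lhs => rw [← hp.map_eq]
  have hmeas : Measurable fun ω : MarkedPoints 𝕏 => {ω | ConnOn φ S ω}.indicator (fun _ => (1 : ℂ)) ω *
      Complex.exp ((t * connCount k φ U ω : ℝ) * Complex.I) :=
    (measurable_const.indicator hmS).mul (measurable_exp_connCount k hφ _ t)
  rw [integral_map hp.measurable.aemeasurable hmeas.aestronglyMeasurable]
  have hd : ∀ i ∈ U, i ∉ (S : Set ℕ) := fun i hi hS => Finset.disjoint_left.1 h hS hi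
  have key : ∀ z : MarkedPoints 𝕏 × MarkedPoints 𝕏,
      {ω | ConnOn φ S ω}.indicator (fun _ => (1 : ℂ)) (splice (S : Set ℕ) ((S : Set ℕ) ×ˢ (S : Set ℕ)) z) *
        Complex.exp ((t * connCount k φ U (splice (S : Set ℕ) ((S : Set ℕ) ×ˢ (S : Set ℕ)) z) : ℝ) *
          Complex.I) =
      {ω | ConnOn φ S ω}.indicator (fun _ => (1 : ℂ)) z.1 *
        Complex.exp ((t * connCount k φ U z.2 : ℝ) * Complex.I) := by
    intro z
    rw [connCount_congr fun T hT => connOn_splice_right φ (S := T) (fun i hi => hd i (hT hi))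
      (fun i hi j hj hm => hd i (hT hi) hm.1) z]
    have := connOn_splice_left φ (S := S) (A := (S : Set ℕ)) (B := (S : Set ℕ) ×ˢ (S : Set ℕ))
      (fun i hi => hi) (fun i hi j hj => ⟨hi, hj⟩) z
    simp only [Set.indicator_apply, Set.mem_ofPred_eq, this]
  simp only [key]
  rw [integral_prod_mul (fun ω => {ω | ConnOn φ S ω}.indicator (fun _ => (1 : ℂ)) ω)
    (fun ω => Complex.exp ((t * connCount k φ U ω : ℝ) * Complex.I)), ← connCharFun_eq k hφ U,
    ← pointLaw_real_connOn hφ, integral_indicator_const _ hmS]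
  simp [connCharFun]

lemma norm_integral_connCount_mul_exp_sub_le (k : ℕ) (hk : 0 < k)
    (hφ : Measurable (Function.uncurry φ)) (n : ℕ) (t : ℝ) :
    ‖∫ ω, (connCount k φ (Finset.range n) ω : ℂ) *
        Complex.exp ((t * connCount k φ (Finset.range n) ω : ℝ) * Complex.I) ∂(pointLaw μ) -
      n.choose k * (connProb μ φ k * Complex.exp (t * Complex.I) *
        connCharFun μ k φ (Finset.range (n - k)) t)‖ ≤
    |t| * ∑ m ∈ Finset.Ioo k (2 * k), (n.choose m : ℝ) * (4 ^ m * connProb μ φ m) := by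
  classical
  set U := Finset.range n with hU
  have hmeasI : ∀ S : Finset ℕ, Measurable fun ω : MarkedPoints 𝕏 =>
      {ω | ConnOn φ S ω}.indicator (fun _ => (1 : ℂ)) ω := fun S =>
    measurable_const.indicator (measurableSet_connOn hφ S)
  have hint : ∀ S U : Finset ℕ, Integrable (fun ω : MarkedPoints 𝕏 =>
      {ω | ConnOn φ S ω}.indicator (fun _ => (1 : ℂ)) ω *
        Complex.exp ((t * connCount k φ U ω : ℝ) * Complex.I)) (pointLaw μ) := by
    intro S U
    refine Integrable.of_bound (C := 1)
      ((hmeasI S).mul (measurable_exp_connCount k hφ U t)).aestronglyMeasurable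
      (ae_of_all _ fun ω => ?_)
    rw [norm_mul, Complex.norm_exp_ofReal_mul_I, mul_one]
    simp only [Set.indicator_apply]
    split_ifs <;> simp
  have h1 : ∫ ω, (connCount k φ U ω : ℂ) *
        Complex.exp ((t * connCount k φ U ω : ℝ) * Complex.I) ∂(pointLaw μ) =
      ∑ S ∈ U.powersetCard k, ∫ ω, {ω | ConnOn φ S ω}.indicator (fun _ => (1 : ℂ)) ω *
        Complex.exp ((t * connCount k φ U ω : ℝ) * Complex.I) ∂(pointLaw μ) := by
    rw [← integral_finsetSum _ fun S _ => hint S U]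
    refine integral_congr_ae (ae_of_all _ fun ω => ?_)
    simp only
    rw [← Finset.sum_mul]
    congr 1
    rw [connCount_eq_sum_indicator]
    push_cast
    refine Finset.sum_congr rfl fun T _ => ?_
    simp only [Set.indicator_apply]
    split_ifs <;> simp
  have h2 : (n.choose k : ℂ) * (connProb μ φ k * Complex.exp (t * Complex.I) *
        connCharFun μ k φ (Finset.range (n - k)) t) =
      ∑ S ∈ U.powersetCard k, ∫ ω, Complex.exp (t * Complex.I) *
        ({ω | ConnOn φ S ω}.indicator (fun _ => (1 : ℂ)) ω *
        Complex.exp ((t * connCount k φ (U \ S) ω : ℝ) * Complex.I)) ∂(pointLaw μ) := by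
    rw [Finset.sum_congr rfl fun S hS => ?_, Finset.sum_const, Finset.card_powersetCard,
      nsmul_eq_mul, hU, Finset.card_range]
    obtain ⟨hSU, hSc⟩ := Finset.mem_powersetCard.1 hS
    rw [integral_const_mul, integral_indicator_connOn_mul_exp k hφ Finset.disjoint_sdiff,
      Finset.card_sdiff_of_subset hSU, hSc, hU, Finset.card_range]
    ring
  rw [h1, h2, ← Finset.sum_sub_distrib]
  refine (norm_sum_le _ _).trans ?_
  have hterm : ∀ S ∈ U.powersetCard k,
      ‖∫ ω, {ω | ConnOn φ S ω}.indicator (fun _ => (1 : ℂ)) ω *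
          Complex.exp ((t * connCount k φ U ω : ℝ) * Complex.I) ∂(pointLaw μ) -
        ∫ ω, Complex.exp (t * Complex.I) * ({ω | ConnOn φ S ω}.indicator (fun _ => (1 : ℂ)) ω *
          Complex.exp ((t * connCount k φ (U \ S) ω : ℝ) * Complex.I)) ∂(pointLaw μ)‖ ≤
      |t| * ∑ T ∈ (U.powersetCard k).filter (fun T => T ≠ S ∧ ¬ Disjoint S T),
        connProb μ φ (S ∪ T).card := by
    intro S hS
    rw [← integral_sub (hint S U) ((hint S _).const_mul _)]
    have hi : ∀ T : Finset ℕ, Integrable (fun ω : MarkedPoints 𝕏 =>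
        {ω | ConnOn φ (S ∪ T) ω}.indicator (fun _ => (1 : ℝ)) ω) (pointLaw μ) := fun T =>
      (integrable_const _).indicator (measurableSet_connOn hφ _)
    refine (norm_integral_le_of_norm_le ((integrable_finsetSum _ fun T _ => hi T).const_mul |t|)
      (ae_of_all _ fun ω => norm_indicator_mul_exp_sub_le k hS hk t ω)).trans_eq ?_
    rw [integral_const_mul, integral_finsetSum _ fun T _ => hi T]
    congr 1
    refine Finset.sum_congr rfl fun T _ => ?_
    rw [integral_indicator_const _ (measurableSet_connOn hφ _), smul_eq_mul, mul_one,
      pointLaw_real_connOn hφ]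
  refine (Finset.sum_le_sum hterm).trans ?_
  rw [← Finset.mul_sum]
  refine mul_le_mul_of_nonneg_left ?_ (abs_nonneg t)
  have := sum_overlapping_pairs_le U k (connProb_nonneg μ φ)
  rwa [hU, Finset.card_range] at this

end FixedNumber

/-! ### Averaging over the Poisson number of points -/

section Poisson

lemma poisson_weight_mul_choose (s : ℝ) (m k : ℕ) :
    Real.exp (-s) * s ^ (m + k) / (m + k).factorial * ((m + k).choose k : ℝ) =
      s ^ k / k.factorial * (Real.exp (-s) * s ^ m / m.factorial) := by
  have h := Nat.add_choose_mul_factorial_mul_factorial m k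
  have hm : (m.factorial : ℝ) ≠ 0 := by positivity
  have hk : (k.factorial : ℝ) ≠ 0 := by positivity
  have hmk : ((m + k).factorial : ℝ) ≠ 0 := by positivity
  have h' : ((m + k).choose k : ℝ) * m.factorial * k.factorial = (m + k).factorial := by
    exact_mod_cast h
  have hc : ((m + k).choose k : ℝ) ≠ 0 := by
    exact_mod_cast (Nat.choose_pos (Nat.le_add_left k m)).ne'
  rw [← h'] at hmk ⊢
  field_simp
  rw [pow_add, mul_comm]

lemma integrable_choose_poissonMeasure (s : ℝ≥0) (k : ℕ) :
    Integrable (fun n : ℕ => (n.choose k : ℝ)) (poissonMeasure s) := by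
  rw [integrable_poissonMeasure_iff, ← summable_nat_add_iff k]
  have := (hasSum_one_poissonMeasure s).summable.mul_left ((s : ℝ) ^ k / k.factorial)
  refine this.congr fun m => ?_
  rw [← poisson_weight_mul_choose]
  simp

/-- Choosing `k` of the points and removing them leaves a Poisson(`s`) number: the Mecke formula at
the level of point counts. -/
lemma integral_choose_mul_poissonMeasure (s : ℝ≥0) (k : ℕ) (h : ℕ → ℂ) :
    ∫ n, (n.choose k : ℂ) * h (n - k) ∂(poissonMeasure s) =
      ((s : ℝ) ^ k / k.factorial : ℝ) * ∫ n, h n ∂(poissonMeasure s) := by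
  rw [integral_poissonMeasure, integral_poissonMeasure, ← tsum_mul_left]
  rw [← (add_left_injective k).tsum_eq]
  · refine tsum_congr fun m => ?_
    have := poisson_weight_mul_choose s m k
    simp only [Nat.add_sub_cancel, Complex.real_smul]
    rw [← mul_assoc, ← mul_assoc, ← Complex.ofReal_mul, ← this]
    push_cast
    ring
  -- Terms with `n < k` vanish with the binomial coefficient, so the truncated subtraction `n - k`
  -- does no harm.
  · intro n hn
    by_contra hr
    have : n < k := by
      by_contra! hle
      exact hr ⟨n - k, by simp [hle]⟩
    simp [Nat.choose_eq_zero_of_lt this] at hn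

lemma integral_choose_poissonMeasure (s : ℝ≥0) (k : ℕ) :
    ∫ n, (n.choose k : ℝ) ∂(poissonMeasure s) = (s : ℝ) ^ k / k.factorial := by
  have h := integral_choose_mul_poissonMeasure s k fun _ => 1
  simp only [mul_one, integral_const, probReal_univ, one_smul] at h
  have h2 : ∫ n, (n.choose k : ℂ) ∂(poissonMeasure s) =
      ((∫ n, (n.choose k : ℝ) ∂(poissonMeasure s) : ℝ) : ℂ) := by
    rw [← integral_complex_ofReal]
    simp
  rw [h2] at h
  exact_mod_cast h

end Poisson

section RandomGraph

lemma irgLaw_eq {𝕏 : Type*} [MeasurableSpace 𝕏] (μ : Measure 𝕏) (s : ℝ≥0) :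
    irgLaw μ s = (poissonMeasure s).prod (pointLaw μ) := rfl

variable {𝕏 : Type*} [MeasurableSpace 𝕏] {μ : Measure 𝕏} [IsProbabilityMeasure μ] {φ : 𝕏 → 𝕏 → ℝ}

lemma integrable_irgCount (k : ℕ) (hφ : Measurable (Function.uncurry φ)) (s : ℝ≥0) :
    Integrable (fun ω => (irgCount k φ ω : ℝ)) (irgLaw μ s) := by
  have hm : Measurable fun ω : IRGSample 𝕏 => (irgCount k φ ω : ℝ) :=
    measurable_from_top.comp (measurable_irgCount k hφ)
  have hd : Integrable (fun ω : IRGSample 𝕏 => (ω.1.choose k : ℝ)) (irgLaw μ s) := by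
    rw [irgLaw_eq]
    exact (integrable_choose_poissonMeasure s k).comp_fst (pointLaw μ)
  refine hd.mono' hm.aestronglyMeasurable (ae_of_all _ fun ω => ?_)
  rw [Real.norm_natCast, irgCount_eq_connCount]
  have := connCount_le_choose k φ (Finset.range ω.1) ω.2
  rw [Finset.card_range] at this
  exact_mod_cast this

lemma integral_connCount_range (k : ℕ) (hφ : Measurable (Function.uncurry φ)) (n : ℕ) :
    ∫ ω, (connCount k φ (Finset.range n) ω : ℝ) ∂(pointLaw μ) = n.choose k * connProb μ φ k := by
  classical
  have h : ∀ ω, (connCount k φ (Finset.range n) ω : ℝ) = ∑ S ∈ (Finset.range n).powersetCard k,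
      {ω | ConnOn φ S ω}.indicator (fun _ => (1 : ℝ)) ω := by
    intro ω
    rw [connCount_eq_sum_indicator]
    push_cast
    refine Finset.sum_congr rfl fun T _ => ?_
    simp only [Set.indicator_apply]
    split_ifs <;> simp
  simp only [h]
  rw [integral_finsetSum _ fun T _ => (integrable_const _).indicator (measurableSet_connOn hφ T),
    Finset.sum_congr rfl fun T hT => ?_, Finset.sum_const, Finset.card_powersetCard, nsmul_eq_mul,
    Finset.card_range]
  rw [integral_indicator_const _ (measurableSet_connOn hφ _), smul_eq_mul, mul_one,
      pointLaw_real_connOn hφ, (Finset.mem_powersetCard.1 hT).2]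

lemma irgMean_eq (k : ℕ) (hφ : Measurable (Function.uncurry φ)) (s : ℝ≥0) :
    irgMean μ k φ s = (s : ℝ) ^ k / k.factorial * connProb μ φ k := by
  have hi := integrable_irgCount (μ := μ) k hφ s
  rw [irgMean]
  rw [irgLaw_eq] at hi ⊢
  rw [integral_prod _ hi]
  simp only [irgCount_eq_connCount, integral_connCount_range k hφ]
  rw [integral_mul_const, integral_choose_poissonMeasure]

/-- The characteristic function of `H_k(G(P_s, φ))`. -/
noncomputable def irgCharFun (μ : Measure 𝕏) (k : ℕ) (φ : 𝕏 → 𝕏 → ℝ) (s : ℝ≥0) (t : ℝ) : ℂ :=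
  ∫ ω, Complex.exp ((t * irgCount k φ ω : ℝ) * Complex.I) ∂(irgLaw μ s)

lemma measurable_exp_irgCount (k : ℕ) (hφ : Measurable (Function.uncurry φ)) (t : ℝ) :
    Measurable fun ω : IRGSample 𝕏 => Complex.exp ((t * irgCount k φ ω : ℝ) * Complex.I) := by
  have h2 : Measurable fun ω : IRGSample 𝕏 => (irgCount k φ ω : ℝ) :=
    measurable_from_top.comp (measurable_irgCount k hφ)
  fun_prop

lemma irgCharFun_eq (k : ℕ) (hφ : Measurable (Function.uncurry φ)) (s : ℝ≥0) (t : ℝ) :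
    irgCharFun μ k φ s t = ∫ n, connCharFun μ k φ (Finset.range n) t ∂(poissonMeasure s) := by
  have hi : Integrable (fun ω => Complex.exp ((t * irgCount k φ ω : ℝ) * Complex.I))
      (irgLaw μ s) :=
    Integrable.of_bound (C := 1) (measurable_exp_irgCount k hφ t).aestronglyMeasurable
      (ae_of_all _ fun ω => (Complex.norm_exp_ofReal_mul_I _).le)
  rw [irgCharFun]
  rw [irgLaw_eq] at hi ⊢
  rw [integral_prod _ hi]
  simp only [irgCount_eq_connCount, connCharFun]

lemma integrable_irgCount_mul_exp (k : ℕ) (hφ : Measurable (Function.uncurry φ)) (s : ℝ≥0) (t : ℝ) :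
    Integrable (fun ω => (irgCount k φ ω : ℂ) *
        Complex.exp ((t * irgCount k φ ω : ℝ) * Complex.I)) (irgLaw μ s) := by
  have hm : Measurable fun ω : IRGSample 𝕏 => (irgCount k φ ω : ℂ) :=
    measurable_from_top.comp (measurable_irgCount k hφ)
  refine (integrable_irgCount k hφ s).mono'
    (hm.mul (measurable_exp_irgCount k hφ t)).aestronglyMeasurable (ae_of_all _ fun ω => ?_)
  rw [norm_mul, Complex.norm_exp_ofReal_mul_I, mul_one, Complex.norm_natCast]

/-- The mean number of ordered overlapping pairs is at most this quantity. -/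
noncomputable def overlapBound (μ : Measure 𝕏) (k : ℕ) (φ : 𝕏 → 𝕏 → ℝ) (s : ℝ≥0) : ℝ :=
  ∑ m ∈ Finset.Ioo k (2 * k), (s : ℝ) ^ m / m.factorial * (4 ^ m * connProb μ φ m)

/-- Averaging the bound for `n` points: the Mecke formula turns the characteristic function at `n -
k` points back into the full one. -/
lemma norm_integral_irgCount_mul_exp_sub_le (k : ℕ) (hk : 0 < k)
    (hφ : Measurable (Function.uncurry φ)) (s : ℝ≥0) (t : ℝ) :
    ‖∫ ω, (irgCount k φ ω : ℂ) * Complex.exp ((t * irgCount k φ ω : ℝ) * Complex.I) ∂(irgLaw μ s) -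
      irgMean μ k φ s * Complex.exp (t * Complex.I) * irgCharFun μ k φ s t‖ ≤
    |t| * overlapBound μ k φ s := by
  have hi := integrable_irgCount_mul_exp (μ := μ) k hφ s t
  have hch : ∀ m : ℕ, Integrable (fun n : ℕ => (n.choose m : ℝ)) (poissonMeasure s) :=
    integrable_choose_poissonMeasure s
  have h1 : (irgMean μ k φ s : ℂ) * Complex.exp (t * Complex.I) * irgCharFun μ k φ s t =
      ∫ n, (n.choose k : ℂ) * (connProb μ φ k * Complex.exp (t * Complex.I) *
        connCharFun μ k φ (Finset.range (n - k)) t) ∂(poissonMeasure s) := by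
    rw [integral_choose_mul_poissonMeasure s k fun n => (connProb μ φ k * Complex.exp (t * Complex.I) *
        connCharFun μ k φ (Finset.range n) t), integral_const_mul, ← irgCharFun_eq k hφ,
      irgMean_eq k hφ]
    push_cast
    ring
  rw [h1]
  rw [irgLaw_eq] at hi ⊢
  rw [integral_prod _ hi, ← integral_sub hi.integral_prod_left]
  · simp only [irgCount_eq_connCount]
    refine (norm_integral_le_of_norm_le (Integrable.const_mul (integrable_finsetSum _ fun m _ =>
      (hch m).mul_const _) |t|)
      (ae_of_all _ fun n => norm_integral_connCount_mul_exp_sub_le k hk hφ n t)).trans_eq ?_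
    rw [integral_const_mul, integral_finsetSum _ fun m _ => (hch m).mul_const _, overlapBound]
    simp only [integral_mul_const, integral_choose_poissonMeasure]
  · refine ((hch k).mul_const (connProb μ φ k)).mono' .of_discrete (ae_of_all _ fun n => ?_)
    rw [norm_mul, norm_mul, norm_mul, Complex.norm_exp_ofReal_mul_I, Complex.norm_natCast, mul_one,
      Complex.norm_real, Real.norm_of_nonneg (connProb_nonneg μ φ k)]
    refine mul_le_mul_of_nonneg_left ?_ (Nat.cast_nonneg _)
    exact mul_le_of_le_one_right (connProb_nonneg μ φ k) (norm_connCharFun_le k _ t)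

end RandomGraph

/-! ### Stability of the Poisson differential equation -/

section Analysis

lemma norm_exp_mul_exp_mul_I_sub_one (c t : ℝ) :
    ‖Complex.exp (c * (Complex.exp (t * Complex.I) - 1))‖ = Real.exp (c * (Real.cos t - 1)) := by
  rw [Complex.norm_exp]
  congr 1
  simp [Complex.exp_ofReal_mul_I_re]

/-- A function which almost satisfies the differential equation of the Poisson characteristic
function is close to it. -/
lemma norm_sub_poisson_charFun_le {f f' : ℝ → ℂ} {c R : ℝ} (hc : 0 ≤ c) (hR : 0 ≤ R)
    (hf : ∀ t, HasDerivAt f (f' t) t) (hf0 : f 0 = 1)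
    (hf' : ∀ t : ℝ, ‖f' t - Complex.I * (c * Complex.exp (t * Complex.I) * f t)‖ ≤ |t| * R) (t : ℝ) :
    ‖f t - Complex.exp (c * (Complex.exp (t * Complex.I) - 1))‖ ≤
      R * t ^ 2 * Real.exp (c * (t ^ 2 / 2)) := by
  -- Integrating factor: the reciprocal of the Poisson characteristic function. The derivative of `f
  -- * E` contains only the error in the equation.
  let E : ℝ → ℂ := fun u => Complex.exp ((-c : ℝ) * (Complex.exp (u * Complex.I) - 1))
  have hE : ∀ u, HasDerivAt E (E u * ((-c : ℝ) * (Complex.exp (u * Complex.I) * Complex.I))) u := by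
    intro u
    have h1 : HasDerivAt (fun u : ℝ => (u : ℂ) * Complex.I) Complex.I u := by
      simpa using (Complex.ofRealCLM.hasDerivAt (x := u)).mul_const Complex.I
    exact ((h1.cexp.sub_const 1).const_mul ((-c : ℝ) : ℂ)).cexp
  have hEn : ∀ u ∈ Set.uIcc 0 t, ‖E u‖ ≤ Real.exp (c * (t ^ 2 / 2)) := by
    intro u hu
    -- The modulus is `exp(c (1 - cos u))`, and `1 - cos u ≤ u²/2`.
    rw [norm_exp_mul_exp_mul_I_sub_one]
    refine Real.exp_le_exp.2 ?_
    have h1 := Real.one_sub_sq_div_two_le_cos (x := u)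
    have h2 : u ^ 2 ≤ t ^ 2 := by
      have := Set.abs_sub_left_of_mem_uIcc hu
      simp only [sub_zero] at this
      exact sq_le_sq.2 this
    nlinarith
  have hut : ∀ u ∈ Set.uIcc 0 t, |u| ≤ |t| := by
    intro u hu
    simpa using Set.abs_sub_left_of_mem_uIcc hu
  have hg : ∀ u, HasDerivAt (fun u => f u * E u)
      (f' u * E u + f u * (E u * ((-c : ℝ) * (Complex.exp (u * Complex.I) * Complex.I)))) u :=
    fun u => (hf u).mul (hE u)
  have hbound : ∀ u ∈ Set.uIcc 0 t,
      ‖f' u * E u + f u * (E u * ((-c : ℝ) * (Complex.exp (u * Complex.I) * Complex.I)))‖ ≤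
        |t| * R * Real.exp (c * (t ^ 2 / 2)) := by
    intro u hu
    have e : f' u * E u + f u * (E u * ((-c : ℝ) * (Complex.exp (u * Complex.I) * Complex.I))) =
        (f' u - Complex.I * (c * Complex.exp (u * Complex.I) * f u)) * E u := by
      push_cast
      ring
    rw [e, norm_mul]
    exact mul_le_mul ((hf' u).trans (mul_le_mul_of_nonneg_right (hut u hu) hR)) (hEn u hu)
      (norm_nonneg _) (by positivity)
  have hmv := (convex_uIcc (0 : ℝ) t).norm_image_sub_le_of_norm_hasDerivWithin_le
    (fun u _ => (hg u).hasDerivWithinAt) hbound Set.left_mem_uIcc Set.right_mem_uIcc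
  have hE0 : E 0 = 1 := by simp [E]
  simp only [hf0, hE0, mul_one, sub_zero, Real.norm_eq_abs] at hmv
  have hinv : E t * Complex.exp (c * (Complex.exp (t * Complex.I) - 1)) = 1 := by
    simp only [E]
    rw [← Complex.exp_add]
    simp
  have e : f t - Complex.exp (c * (Complex.exp (t * Complex.I) - 1)) =
      (f t * E t - 1) * Complex.exp (c * (Complex.exp (t * Complex.I) - 1)) := by
    rw [sub_mul, mul_assoc, hinv]
    ring
  rw [e, norm_mul, norm_exp_mul_exp_mul_I_sub_one]
  have hle : Real.exp (c * (Real.cos t - 1)) ≤ 1 := by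
    rw [Real.exp_le_one_iff]
    nlinarith [Real.cos_le_one t]
  refine (mul_le_of_le_one_right (norm_nonneg _) hle).trans (hmv.trans_eq ?_)
  rw [← sq_abs t]
  ring

end Analysis

/-! ### Consequences of homogeneity -/

section Basic

variable {𝕏 : Type*} [MeasurableSpace 𝕏] {μ : Measure 𝕏} {φ : 𝕏 → 𝕏 → ℝ}

lemma irgMean_nonneg (k : ℕ) (s : ℝ≥0) : 0 ≤ irgMean μ k φ s :=
  integral_nonneg fun _ => Nat.cast_nonneg _

lemma overlapBound_nonneg (k : ℕ) (s : ℝ≥0) : 0 ≤ overlapBound μ k φ s :=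
  Finset.sum_nonneg fun m _ =>
    mul_nonneg (by positivity) (mul_nonneg (by positivity) (connProb_nonneg μ φ m))

/-- The supremum over `x` of `∫ φ(x, y) μ(dy)`. -/
noncomputable def maxConn (μ : Measure 𝕏) (φ : 𝕏 → 𝕏 → ℝ) : ℝ := ⨆ x, ∫ y, φ x y ∂μ

lemma IsConnectionFunction.maxConn_nonneg (hφ : IsConnectionFunction φ) : 0 ≤ maxConn μ φ :=
  Real.iSup_nonneg fun x => integral_nonneg (hφ.nonneg x)

lemma IsHomogeneousConnection.mul_maxConn_le {ε : ℝ} (hφ : IsHomogeneousConnection μ ε φ) (x : 𝕏) :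
    ε * maxConn μ φ ≤ ∫ y, φ x y ∂μ :=
  hφ.homogeneous.trans (ciInf_le (f := fun x => ∫ y, φ x y ∂μ)
    ⟨0, by rintro _ ⟨x, rfl⟩; exact integral_nonneg (hφ.nonneg x)⟩ x)

end Basic

section RandomGraph

variable {𝕏 : Type*} [MeasurableSpace 𝕏] {μ : Measure 𝕏} [IsProbabilityMeasure μ] {φ : 𝕏 → 𝕏 → ℝ}

lemma hasDerivAt_irgCharFun (k : ℕ) (hφ : Measurable (Function.uncurry φ)) (s : ℝ≥0) (t : ℝ) :
    HasDerivAt (irgCharFun μ k φ s) (Complex.I * ∫ ω, (irgCount k φ ω : ℂ) *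
      Complex.exp ((t * irgCount k φ ω : ℝ) * Complex.I) ∂(irgLaw μ s)) t := by
  rw [← integral_const_mul]
  have hm := fun t => measurable_exp_irgCount k hφ t
  refine (hasDerivAt_integral_of_dominated_loc_of_deriv_le (μ := irgLaw μ s)
    (F := fun t ω => Complex.exp ((t * irgCount k φ ω : ℝ) * Complex.I))
    (F' := fun t ω => Complex.I * ((irgCount k φ ω : ℂ) *
      Complex.exp ((t * irgCount k φ ω : ℝ) * Complex.I)))
    (s := Set.univ) (bound := fun ω => (irgCount k φ ω : ℝ)) univ_mem
    (Eventually.of_forall fun t => (hm t).aestronglyMeasurable) ?_ ?_ ?_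
    (integrable_irgCount k hφ s) ?_).2
  · exact Integrable.of_bound (C := 1) (hm t).aestronglyMeasurable
      (ae_of_all _ fun ω => (Complex.norm_exp_ofReal_mul_I _).le)
  · exact ((integrable_irgCount_mul_exp k hφ s t).const_mul _).aestronglyMeasurable
  · refine ae_of_all _ fun ω u _ => ?_
    rw [norm_mul, norm_mul, Complex.norm_exp_ofReal_mul_I, mul_one, Complex.norm_natCast,
      Complex.norm_I, one_mul]
  · refine ae_of_all _ fun ω u _ => ?_
    have h1 : HasDerivAt (fun u : ℝ => ((u * irgCount k φ ω : ℝ) : ℂ) * Complex.I)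
        ((irgCount k φ ω : ℂ) * Complex.I) u := by
      have h := ((Complex.ofRealCLM.hasDerivAt (x := u)).mul_const
        (irgCount k φ ω : ℂ)).mul_const Complex.I
      simpa using h
    convert! h1.cexp using 1
    ring

lemma norm_irgCharFun_sub_le (k : ℕ) (hk : 0 < k) (hφ : Measurable (Function.uncurry φ)) (s : ℝ≥0)
    (t : ℝ) :
    ‖irgCharFun μ k φ s t - Complex.exp (irgMean μ k φ s * (Complex.exp (t * Complex.I) - 1))‖ ≤
      overlapBound μ k φ s * t ^ 2 * Real.exp (irgMean μ k φ s * (t ^ 2 / 2)) := by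
  refine norm_sub_poisson_charFun_le (irgMean_nonneg k s) (overlapBound_nonneg k s)
    (hasDerivAt_irgCharFun k hφ s) (by simp [irgCharFun]) (fun u => ?_) t
  rw [← mul_sub, norm_mul, Complex.norm_I, one_mul]
  exact norm_integral_irgCount_mul_exp_sub_le k hk hφ s u

lemma IsConnectionFunction.integral_le_one (hφ : IsConnectionFunction φ) (x : 𝕏) :
    ∫ y, φ x y ∂μ ≤ 1 :=
  (integral_mono (hφ.integrable x) (integrable_const 1) (hφ.le_one x)).trans_eq (by simp)

lemma IsConnectionFunction.integral_le_maxConn (hφ : IsConnectionFunction φ) (x : 𝕏) :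
    ∫ y, φ x y ∂μ ≤ maxConn μ φ :=
  le_ciSup (f := fun x => ∫ y, φ x y ∂μ) ⟨1, by rintro _ ⟨x, rfl⟩; exact hφ.integral_le_one x⟩ x

lemma le_irgMean {ε : ℝ} (hε : 0 ≤ ε) (hφ : IsHomogeneousConnection μ ε φ) {k : ℕ} (hk : 0 < k)
    (s : ℝ≥0) :
    (s : ℝ) ^ k / k.factorial * (ε * maxConn μ φ) ^ (k - 1) ≤ irgMean μ k φ s := by
  rw [irgMean_eq k hφ.measurable]
  refine mul_le_mul_of_nonneg_left ?_ (by positivity)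
  obtain ⟨m, rfl⟩ := Nat.exists_eq_add_of_le' hk
  exact le_connProb hφ.toIsConnectionFunction
    (mul_nonneg hε hφ.maxConn_nonneg) hφ.mul_maxConn_le m

/-- A polynomial, vanishing at zero, which bounds the relative size of `overlapBound`. -/
noncomputable def overlapRatio (ε : ℝ) (k : ℕ) (x : ℝ) : ℝ :=
  ∑ m ∈ Finset.Ioo k (2 * k), k.factorial / ε ^ (k - 1) * (4 ^ m * ((m : ℝ) ^ 2) ^ (m - 1)) *
    x ^ (m - k)

lemma tendsto_overlapRatio (ε : ℝ) (k : ℕ) : Tendsto (overlapRatio ε k) (𝓝 0) (𝓝 0) := by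
  have hc : Continuous (overlapRatio ε k) := by
    unfold overlapRatio
    fun_prop
  have h0 : overlapRatio ε k 0 = 0 := by
    refine Finset.sum_eq_zero fun m hm => ?_
    have := (Finset.mem_Ioo.1 hm).1
    rw [zero_pow (by omega), mul_zero]
  simpa [h0] using hc.tendsto 0

/-- The term for `m` is of order at most `s^m p^(m-1)` with `p = maxConn μ φ`, while the mean is at
least of order `s^k p^(k-1)`. Their quotient is `(sp)^(m-k)` with `m > k`. -/
lemma overlapBound_le {ε : ℝ} (hε : 0 < ε) (hφ : IsHomogeneousConnection μ ε φ) {k : ℕ} (hk : 0 < k)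
    (s : ℝ≥0) :
    overlapBound μ k φ s ≤ irgMean μ k φ s * overlapRatio ε k (s * maxConn μ φ) := by
  rw [overlapBound, overlapRatio, Finset.mul_sum]
  refine Finset.sum_le_sum fun m hm => ?_
  have hkm := (Finset.mem_Ioo.1 hm).1
  have hp : 0 ≤ maxConn μ φ := hφ.maxConn_nonneg
  have h1 : connProb μ φ m ≤ ((m : ℝ) ^ 2 * maxConn μ φ) ^ (m - 1) := by
    obtain ⟨j, rfl⟩ := Nat.exists_eq_add_of_le' (show 1 ≤ m by omega)
    have := connProb_le hφ.toIsConnectionFunction hp (hφ.integral_le_maxConn) j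
    simpa using this
  have h2 : (s : ℝ) ^ m / m.factorial ≤ (s : ℝ) ^ m :=
    div_le_self (by positivity) (by exact_mod_cast Nat.one_le_iff_ne_zero.2 m.factorial_ne_zero)
  calc (s : ℝ) ^ m / m.factorial * (4 ^ m * connProb μ φ m)
      ≤ (s : ℝ) ^ m * (4 ^ m * ((m : ℝ) ^ 2 * maxConn μ φ) ^ (m - 1)) := by
        gcongr
        exact mul_nonneg (by positivity) (connProb_nonneg μ φ m)
    _ = (s : ℝ) ^ k / k.factorial * (ε * maxConn μ φ) ^ (k - 1) *
          (k.factorial / ε ^ (k - 1) * (4 ^ m * ((m : ℝ) ^ 2) ^ (m - 1)) *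
            (s * maxConn μ φ) ^ (m - k)) := by
        have e1 : (s : ℝ) ^ m = (s : ℝ) ^ k * (s : ℝ) ^ (m - k) := by
          rw [← pow_add]; congr 1; omega
        have e2 : maxConn μ φ ^ (m - 1) = maxConn μ φ ^ (k - 1) * maxConn μ φ ^ (m - k) := by
          rw [← pow_add]; congr 1; omega
        have hk' : (k.factorial : ℝ) ≠ 0 := by positivity
        rw [mul_pow _ (maxConn μ φ), mul_pow _ (maxConn μ φ), mul_pow _ (maxConn μ φ), e1, e2]
        field_simp
    _ ≤ _ := by
        refine mul_le_mul_of_nonneg_right (le_irgMean hε.le hφ hk s) (by positivity)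

/-- If the mean of the count is `o(s)`, the mean degree tends to zero. -/
lemma tendsto_mul_maxConn {ε : ℝ} (hε : 0 < ε) {k : ℕ} (hk : 2 ≤ k) {φ : ℝ≥0 → 𝕏 → 𝕏 → ℝ}
    (hφ : ∀ s, 0 < s → IsHomogeneousConnection μ ε (φ s))
    (h : (fun s => irgMean μ k (φ s) s) =o[atTop] (fun s : ℝ≥0 => (s : ℝ))) :
    Tendsto (fun s : ℝ≥0 => (s : ℝ) * maxConn μ (φ s)) atTop (𝓝 0) := by
  have h0 := (h.tendsto_div_nhds_zero).const_mul (k.factorial / ε ^ (k - 1))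
  rw [mul_zero] at h0
  have hpow : Tendsto (fun s : ℝ≥0 => ((s : ℝ) * maxConn μ (φ s)) ^ (k - 1)) atTop (𝓝 0) := by
    refine tendsto_of_tendsto_of_tendsto_of_le_of_le' tendsto_const_nhds h0 ?_ ?_
    · filter_upwards [eventually_gt_atTop 0] with s hs
      exact pow_nonneg (mul_nonneg s.2 (hφ s hs).maxConn_nonneg) _
    · filter_upwards [eventually_gt_atTop 0] with s hs
      have hs' : (0 : ℝ) < s := hs
      have h1 := le_irgMean hε.le (hφ s hs) (show 0 < k by omega) s
      have hk' : (0 : ℝ) < k.factorial := by positivity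
      rw [← mul_div_assoc, le_div_iff₀ hs']
      -- `s^k p^(k-1) = (sp)^(k-1) s`: the spare factor `s` is why the threshold is `o(s)`.
      calc ((s : ℝ) * maxConn μ (φ s)) ^ (k - 1) * s
          = k.factorial / ε ^ (k - 1) *
              ((s : ℝ) ^ k / k.factorial * (ε * maxConn μ (φ s)) ^ (k - 1)) := by
            have e1 : (s : ℝ) ^ k = (s : ℝ) ^ (k - 1) * s := by
              rw [← pow_succ]; congr 1; omega
            rw [mul_pow, mul_pow, e1]
            field_simp
        _ ≤ _ := by gcongr
  have hr := hpow.rpow_const (p := ((k - 1 : ℕ) : ℝ)⁻¹) (Or.inr (by positivity))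
  rw [Real.zero_rpow (by
    have : ((k - 1 : ℕ) : ℝ) ≠ 0 := Nat.cast_ne_zero.2 (by omega)
    exact inv_ne_zero this)] at hr
  refine hr.congr' ?_
  filter_upwards [eventually_gt_atTop 0] with s hs
  exact Real.pow_rpow_inv_natCast (mul_nonneg s.2 (hφ s hs).maxConn_nonneg) (by omega)

end RandomGraph

/-! ### Weak convergence and the Poisson central limit theorem -/

section Convergence

/-- Along a countably generated filter, convergence can be tested on sequences, where Lévy's
continuity theorem applies. -/
lemma ProbabilityMeasure.tendsto_of_tendsto_charFun_of_isCountablyGenerated {ι : Type*}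
    {l : Filter ι} [l.IsCountablyGenerated] {ν : ι → ProbabilityMeasure ℝ} {ν₀ : ProbabilityMeasure ℝ}
    (h : ∀ t, Tendsto (fun i => charFun (ν i : Measure ℝ) t) l (𝓝 (charFun (ν₀ : Measure ℝ) t))) :
    Tendsto ν l (𝓝 ν₀) :=
  tendsto_of_seq_tendsto fun _ hu =>
    MeasureTheory.ProbabilityMeasure.tendsto_of_tendsto_charFun fun t => (h t).comp hu

/-- Weak convergence on `ℕ` may be checked after embedding `ℕ` into `ℝ`. -/
lemma ProbabilityMeasure.tendsto_nat_of_tendsto_map_cast {ι : Type*} {l : Filter ι}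
    {ν : ι → ProbabilityMeasure ℕ} {ν₀ : ProbabilityMeasure ℕ}
    (h : Tendsto (fun i => (ν i).map (f := ((↑) : ℕ → ℝ)) measurable_from_top.aemeasurable) l
      (𝓝 (ν₀.map (f := ((↑) : ℕ → ℝ)) measurable_from_top.aemeasurable))) :
    Tendsto ν l (𝓝 ν₀) := by
  rw [MeasureTheory.ProbabilityMeasure.tendsto_iff_forall_integral_tendsto] at h ⊢
  intro f
  -- Tietze extension: `ℕ` is closed in `ℝ`, so `f` is the restriction of a bounded continuous
  -- function.
  obtain ⟨g, -, hg⟩ := BoundedContinuousFunction.exists_extension_norm_eq_of_isClosedEmbedding f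
    Nat.isClosedEmbedding_coe_real
  have key : ∀ ν : ProbabilityMeasure ℕ, ∫ x, g x ∂((ν.map (f := ((↑) : ℕ → ℝ))
      measurable_from_top.aemeasurable : ProbabilityMeasure ℝ) : Measure ℝ) = ∫ n, f n ∂(ν : Measure ℕ) := by
    intro ν
    rw [MeasureTheory.ProbabilityMeasure.toMeasure_map,
      integral_map measurable_from_top.aemeasurable g.continuous.aestronglyMeasurable, ← hg]
    rfl
  simpa only [key] using h g

/-- The characteristic function of a normalised Poisson variable tends to the one of the standard
normal distribution, as the mean tends to infinity. -/
lemma tendsto_normalised_poisson_charFun {ι : Type*} {l : Filter ι} {c : ι → ℝ}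
    (hc : Tendsto c l atTop) (t : ℝ) :
    Tendsto (fun i => Complex.exp ((-(t * √(c i)) : ℝ) * Complex.I) *
      Complex.exp (c i * (Complex.exp ((t / √(c i) : ℝ) * Complex.I) - 1))) l
      (𝓝 (Complex.exp (-(t ^ 2 / 2 : ℝ)))) := by
  simp only [← Complex.exp_add]
  refine (Complex.continuous_exp.tendsto _).comp ?_
  have hsqrt : Tendsto (fun i => √(c i)) l atTop := Real.tendsto_sqrt_atTop.comp hc
  rw [tendsto_iff_norm_sub_tendsto_zero]
  have h0 : Tendsto (fun i => |t| ^ 3 / √(c i)) l (𝓝 0) := hsqrt.const_div_atTop _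
  refine squeeze_zero' (Eventually.of_forall fun _ => norm_nonneg _) ?_ h0
  filter_upwards [hc.eventually_gt_atTop 0, hsqrt.eventually_ge_atTop |t|,
    hsqrt.eventually_gt_atTop 0] with i hi hti hsi
  set r := √(c i) with hr
  have hcr : c i = r ^ 2 := (Real.sq_sqrt hi.le).symm
  have hu : ‖((t / r : ℝ) : ℂ) * Complex.I‖ = |t| / r := by
    rw [norm_mul, Complex.norm_I, mul_one, Complex.norm_real, Real.norm_eq_abs, abs_div,
      abs_of_pos hsi]
  have hb := Complex.exp_bound (x := ((t / r : ℝ) : ℂ) * Complex.I) (n := 3)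
    (by rw [hu]; exact div_le_one_of_le₀ hti hsi.le) (by norm_num)
  rw [hu] at hb
  have hrC : (r : ℂ) ≠ 0 := by exact_mod_cast hsi.ne'
  -- The Taylor terms of order at most two account for the centring and the limit `-t²/2`. The
  -- remainder is at most `r² (|t|/r)³ = |t|³/r`.
  have e : ((-(t * r) : ℝ) : ℂ) * Complex.I +
      c i * (Complex.exp ((t / r : ℝ) * Complex.I) - 1) - -((t ^ 2 / 2 : ℝ) : ℂ) =
      (r : ℂ) ^ 2 * (Complex.exp ((t / r : ℝ) * Complex.I) -
        ∑ m ∈ Finset.range 3, (((t / r : ℝ) : ℂ) * Complex.I) ^ m / m.factorial) := by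
    rw [hcr]
    simp only [Finset.sum_range_succ, Finset.sum_range_zero]
    push_cast
    simp only [mul_pow, Complex.I_sq, Nat.factorial]
    field_simp
    push_cast
    ring
  rw [e, norm_mul, norm_pow, Complex.norm_real, Real.norm_of_nonneg hsi.le]
  calc r ^ 2 * _ ≤ r ^ 2 * ((|t| / r) ^ 3 * 1) := by
        refine mul_le_mul_of_nonneg_left (hb.trans ?_) (by positivity)
        refine mul_le_mul_of_nonneg_left ?_ (by positivity)
        norm_num [Nat.factorial]
    _ = |t| ^ 3 / r := by
        field_simp

end Convergence

/-! ### The two limit theorems -/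

section Limit

variable {𝕏 : Type*} [MeasurableSpace 𝕏] {μ : Measure 𝕏} [IsProbabilityMeasure μ]

lemma ae_eq_zero_poissonMeasure_zero : ∀ᵐ n ∂(poissonMeasure 0), n = 0 := by
  have h : poissonMeasure 0 {0} = 1 := by simp [poissonMeasure_singleton]
  exact (prob_compl_eq_zero_iff (measurableSet_singleton 0)).2 h

/-- Nothing is assumed about the connection function at `s = 0`, not even measurability; there the
graph is almost surely empty and the count is zero. -/
lemma aemeasurable_irgCount_zero {k : ℕ} (hk : 0 < k) (φ : 𝕏 → 𝕏 → ℝ) :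
    AEMeasurable (irgCount k φ) (irgLaw μ 0) := by
  refine ⟨fun _ => 0, measurable_const, ?_⟩
  have h : ∀ᵐ ω ∂(irgLaw μ 0), ω.1 = 0 := by
    rw [irgLaw_eq]
    exact measurePreserving_fst.quasiMeasurePreserving.ae ae_eq_zero_poissonMeasure_zero
  filter_upwards [h] with ω hω
  have := connCount_le_choose k φ (Finset.range ω.1) ω.2
  rw [Finset.card_range, hω, Nat.choose_eq_zero_of_lt hk] at this
  rw [irgCount_eq_connCount, hω]
  exact Nat.le_zero.1 this

variable {ε : ℝ} {k : ℕ} {φ : ℝ≥0 → 𝕏 → 𝕏 → ℝ}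

lemma aemeasurable_irgCount (hk : 0 < k) (hφ : ∀ s, 0 < s → IsHomogeneousConnection μ ε (φ s))
    (s : ℝ≥0) : AEMeasurable (irgCount k (φ s)) (irgLaw μ s) := by
  rcases eq_or_ne s 0 with rfl | hs
  · exact aemeasurable_irgCount_zero hk _
  · exact (measurable_irgCount k (hφ s (pos_iff_ne_zero.2 hs)).measurable).aemeasurable

lemma eventually_norm_irgCharFun_sub_le (hε : 0 < ε) (hk : 0 < k)
    (hφ : ∀ s, 0 < s → IsHomogeneousConnection μ ε (φ s)) :
    ∀ᶠ s : ℝ≥0 in atTop, ∀ t : ℝ, ‖irgCharFun μ k (φ s) s t -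
        Complex.exp (irgMean μ k (φ s) s * (Complex.exp (t * Complex.I) - 1))‖ ≤
      overlapRatio ε k (s * maxConn μ (φ s)) * ((irgMean μ k (φ s) s * t ^ 2) *
        Real.exp (irgMean μ k (φ s) s * t ^ 2 / 2)) := by
  filter_upwards [eventually_gt_atTop 0] with s hs t
  refine (norm_irgCharFun_sub_le k hk (hφ s hs).measurable s t).trans ?_
  rw [mul_div_assoc]
  have := overlapBound_le hε (hφ s hs) hk s
  calc overlapBound μ k (φ s) s * t ^ 2 * Real.exp (irgMean μ k (φ s) s * (t ^ 2 / 2))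
      ≤ irgMean μ k (φ s) s * overlapRatio ε k (s * maxConn μ (φ s)) * t ^ 2 *
          Real.exp (irgMean μ k (φ s) s * (t ^ 2 / 2)) := by gcongr
    _ = _ := by ring

/-- The error depends on the frequency only through `α τ²`. A constant `τ` serves the Poisson limit
and `τ = t/√α` the normal one. -/
lemma tendsto_irgCharFun_sub {τ : ℝ≥0 → ℝ} {b : ℝ} (hε : 0 < ε) (hk : 2 ≤ k)
    (hφ : ∀ s, 0 < s → IsHomogeneousConnection μ ε (φ s))
    (h : (fun s => irgMean μ k (φ s) s) =o[atTop] (fun s : ℝ≥0 => (s : ℝ)))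
    (hτ : Tendsto (fun s => irgMean μ k (φ s) s * τ s ^ 2) atTop (𝓝 b)) :
    Tendsto (fun s => irgCharFun μ k (φ s) s (τ s) -
        Complex.exp (irgMean μ k (φ s) s * (Complex.exp (τ s * Complex.I) - 1))) atTop (𝓝 0) := by
  refine squeeze_zero_norm' ((eventually_norm_irgCharFun_sub_le hε (by omega) hφ).mono
    fun s hs => hs (τ s)) ?_
  have h1 := (tendsto_overlapRatio ε k).comp (tendsto_mul_maxConn hε hk hφ h)
  have h2 := h1.mul (hτ.mul ((Real.continuous_exp.tendsto _).comp (hτ.div_const 2)))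
  simpa using h2

lemma tendstoInDistribution_poisson (hε : 0 < ε) (hk : 2 ≤ k)
    (hφ : ∀ s, 0 < s → IsHomogeneousConnection μ ε (φ s)) {α : ℝ≥0}
    (h : Tendsto (fun s => irgMean μ k (φ s) s) atTop (𝓝 (α : ℝ))) :
    TendstoInDistribution (fun s => irgCount k (φ s)) atTop (id : ℕ → ℕ)
        (fun s => irgLaw μ s) (poissonMeasure α) where
  forall_aemeasurable := aemeasurable_irgCount (by omega) hφ
  tendsto := by
    have ho : (fun s => irgMean μ k (φ s) s) =o[atTop] (fun s : ℝ≥0 => (s : ℝ)) := by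
      refine (h.isBigO_one ℝ).trans_isLittleO ?_
      refine (isLittleO_const_left.2 (Or.inr ?_))
      exact tendsto_norm_atTop_atTop.comp (NNReal.tendsto_coe_atTop.2 tendsto_id)
    refine ProbabilityMeasure.tendsto_nat_of_tendsto_map_cast
      (ProbabilityMeasure.tendsto_of_tendsto_charFun_of_isCountablyGenerated fun t => ?_)
    have hcf : ∀ s, charFun ((irgLaw μ s).map (irgCount k (φ s)) |>.map ((↑) : ℕ → ℝ)) t =
        irgCharFun μ k (φ s) s t := by
      intro s
      have hm := aemeasurable_irgCount (show 0 < k by omega) hφ s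
      rw [charFun_apply_real, integral_map measurable_from_top.aemeasurable (by fun_prop),
        integral_map hm .of_discrete, irgCharFun]
      simp
    change Tendsto (fun s => charFun
        ((irgLaw μ s).map (irgCount k (φ s)) |>.map ((↑) : ℕ → ℝ)) t) atTop
      (𝓝 (charFun ((poissonMeasure α).map id |>.map ((↑) : ℕ → ℝ)) t))
    simp only [hcf, Measure.map_id, charFun_map_cast_poissonMeasure]
    have h1 := tendsto_irgCharFun_sub (τ := fun _ => t) hε hk hφ ho (h.mul_const _)
    have h2 : Tendsto (fun s => Complex.exp (irgMean μ k (φ s) s * (Complex.exp (t * Complex.I) - 1)))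
        atTop (𝓝 (Complex.exp ((α : ℝ) * (Complex.exp (t * Complex.I) - 1)))) :=
      (Complex.continuous_exp.tendsto _).comp
        (((Complex.continuous_ofReal.tendsto _).comp h).mul_const _)
    simpa using h1.add h2

lemma tendstoInDistribution_gaussian (hε : 0 < ε) (hk : 2 ≤ k)
    (hφ : ∀ s, 0 < s → IsHomogeneousConnection μ ε (φ s))
    (h : Tendsto (fun s => irgMean μ k (φ s) s) atTop atTop)
    (ho : (fun s => irgMean μ k (φ s) s) =o[atTop] (fun s : ℝ≥0 => (s : ℝ))) :
    TendstoInDistribution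
        (fun s ω => ((irgCount k (φ s) ω : ℝ) - irgMean μ k (φ s) s)
          / Real.sqrt (irgMean μ k (φ s) s))
        atTop (id : ℝ → ℝ) (fun s => irgLaw μ s) (gaussianReal 0 1) := by
  have hm : ∀ s, AEMeasurable (fun ω => ((irgCount k (φ s) ω : ℝ) - irgMean μ k (φ s) s)
          / Real.sqrt (irgMean μ k (φ s) s)) (irgLaw μ s) := fun s =>
    ((measurable_from_top.comp_aemeasurable
      (aemeasurable_irgCount (show 0 < k by omega) hφ s)).sub_const _).div_const _
  refine ⟨hm, by fun_prop,
    ProbabilityMeasure.tendsto_of_tendsto_charFun_of_isCountablyGenerated fun t => ?_⟩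
  -- Centring contributes a factor of modulus 1, which leaves the error unchanged; scaling moves the
  -- frequency to `t/√α`.
  have hcf : ∀ s, 0 < irgMean μ k (φ s) s →
      charFun ((irgLaw μ s).map fun ω => ((irgCount k (φ s) ω : ℝ) - irgMean μ k (φ s) s)
          / Real.sqrt (irgMean μ k (φ s) s)) t =
      Complex.exp ((-(t * √(irgMean μ k (φ s) s)) : ℝ) * Complex.I) *
        irgCharFun μ k (φ s) s (t / √(irgMean μ k (φ s) s)) := by
    intro s hs
    rw [charFun_apply_real, integral_map (hm s) (by fun_prop), irgCharFun, ← integral_const_mul]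
    refine integral_congr_ae (ae_of_all _ fun ω => ?_)
    simp only
    rw [← Complex.exp_add, ← add_mul, ← Complex.ofReal_add, ← Complex.ofReal_mul]
    congr 3
    have h1 := Real.sqrt_pos.2 hs
    have h2 := Real.sq_sqrt hs.le
    field_simp
    rw [h2]
    ring
  simp only [MeasureTheory.ProbabilityMeasure.coe_mk, Measure.map_id, charFun_gaussianReal]
  have h1 := tendsto_irgCharFun_sub (τ := fun s => t / √(irgMean μ k (φ s) s)) (b := t ^ 2)
    hε hk hφ ho (by
      refine tendsto_const_nhds.congr' ?_
      filter_upwards [h.eventually_gt_atTop 0] with s hs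
      rw [div_pow, Real.sq_sqrt hs.le]
      field_simp)
  have h2 := tendsto_normalised_poisson_charFun h t
  have h3 : Tendsto (fun s => Complex.exp ((-(t * √(irgMean μ k (φ s) s)) : ℝ) * Complex.I) *
      (irgCharFun μ k (φ s) s (t / √(irgMean μ k (φ s) s)) -
        Complex.exp (irgMean μ k (φ s) s *
          (Complex.exp ((t / √(irgMean μ k (φ s) s) : ℝ) * Complex.I) - 1)))) atTop (𝓝 0) := by
    rw [tendsto_zero_iff_norm_tendsto_zero] at h1 ⊢
    simpa only [norm_mul, Complex.norm_exp_ofReal_mul_I, one_mul] using h1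
  have h4 := h3.add h2
  rw [zero_add] at h4
  have e : Complex.exp (-((t ^ 2 / 2 : ℝ) : ℂ)) =
      Complex.exp ((t : ℂ) * ((0 : ℝ) : ℂ) * Complex.I - ((1 : ℝ≥0) : ℝ) * (t : ℂ) ^ 2 / 2) := by
    congr 1
    push_cast
    ring
  rw [e] at h4
  refine h4.congr' ?_
  filter_upwards [h.eventually_gt_atTop 0] with s hs
  rw [hcf s hs]
  ring

end Limit

theorem theorem2p3 {𝕏 : Type*} [MeasurableSpace 𝕏] (μ : Measure 𝕏) [IsProbabilityMeasure μ]
    (ε : ℝ) (hε : 0 < ε) (k : ℕ) (hk : 2 ≤ k)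
    (φ : ℝ≥0 → 𝕏 → 𝕏 → ℝ) (hφ : ∀ s, 0 < s → IsHomogeneousConnection μ ε (φ s)) :
    (∀ α : ℝ≥0, 0 < α →
      Tendsto (fun s => irgMean μ k (φ s) s) atTop (𝓝 (α : ℝ)) →
      TendstoInDistribution (fun s => irgCount k (φ s)) atTop (id : ℕ → ℕ)
        (fun s => irgLaw μ s) (poissonMeasure α)) ∧
    (Tendsto (fun s => irgMean μ k (φ s) s) atTop atTop →
      (fun s => irgMean μ k (φ s) s) =o[atTop] (fun s : ℝ≥0 => (s : ℝ)) →
      TendstoInDistribution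
        (fun s ω => ((irgCount k (φ s) ω : ℝ) - irgMean μ k (φ s) s)
          / Real.sqrt (irgMean μ k (φ s) s))
        atTop (id : ℝ → ℝ) (fun s => irgLaw μ s) (gaussianReal 0 1)) := by
  exact ⟨fun _ _ h => tendstoInDistribution_poisson hε hk hφ h,
    fun h ho => tendstoInDistribution_gaussian hε hk hφ h ho⟩
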